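/- An unrooted binary tree on a finite set $L$ is a tree whose vertices of degree one (its leaves) are the elements of $L$ and whose other, unlabelled, vertices all have degree three. A rooted binary tree on a finite set $S$, $|S|\ge 2$, is a tree with leaf-set $S$ and a distinguished unlabelled root of degree two, all other unlabelled vertices having degree three. Trees are considered up to isomorphisms that fix every leaf (and the root, if there is one). Let $1<a<n$, let $S\subset[n]$ with $|S|=a$, and fix a reference leaf $\ell^*\in[n]\setminus S$. Given an unrooted binary tree $T$ on $[n]$, let $v$ be the vertex adjacent to $\ell^*$, and let $v^*$ be the first common vertex of the $a$ paths in $T$ from the leaves in $S$ toward $v$. The rooted tree induced by $S$ in $T$ is the tree formed by the paths from $v^*$ to the leaves in $S$, rooted at $v^*$, with all its vertices of degree $2$ other than $v^*$ suppressed. (i) For every rooted binary tree $\mathcal T$ on $S$, the number $\mathcal N(\mathcal T)$ of unrooted binary trees $T$ on $[n]$ in which $S$ induces $\mathcal T$ is $$\mathcal N(\mathcal T)=\frac{(2n-5)!!}{(2a-3)!!}.$$ (ii) Let a reference leaf $\ell^*(S)\in[n]\setminus S$ be fixed for every $S\subset[n]$ with $|S|=a$. Let $T'_n,T''_n$ be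 two independent uniformly random unrooted binary trees on $[n]$, and let $X_{n,a}$ be the number of sets $S\subset[n]$ with $|S|=a$ that induce the same rooted tree in $T'_n$ and in $T''_n$. Then $$\mathbb E[X_{n,a}]=\frac{\binom{n}{a}}{(2a-3)!!}.$$ -/

import Mathlib

open scoped Nat

/-- `z` lies on a path of `G` from `x` to `y`; in a tree that path is unique. -/
def IsOnPath {V : Type*} (G : SimpleGraph V) (x y z : V) : Prop :=
  ∃ p : G.Walk x y, p.IsPath ∧ z ∈ p.support

/-- Trace the paths from the vertices of `A` towards `v`: `w` is their first common vertex. That is,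
`w` lies on all these paths, and every vertex that lies on all of them is met at `w` or after `w`. -/
def IsFirstCommonVertex {V : Type*} (G : SimpleGraph V) (A : Set V) (v w : V) : Prop :=
  (∀ x ∈ A, IsOnPath G x v w) ∧ ∀ u, (∀ x ∈ A, IsOnPath G x v u) → IsOnPath G w v u

/-- The vertices of the subtree formed by the paths from `w` to the vertices of `A`. -/
def pathVertices {V : Type*} (G : SimpleGraph V) (A : Set V) (w : V) : Set V :=
  {z | ∃ x ∈ A, IsOnPath G w x z}

/-- The edges of the subtree formed by the paths from `w` to the vertices of `A`. It is given as a
graph on all of `V`, in which the vertices outside the subtree are isolated. -/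
def pathTree {V : Type*} (G : SimpleGraph V) (A : Set V) (w : V) : SimpleGraph V where
  Adj x y := G.Adj x y ∧ x ∈ pathVertices G A w ∧ y ∈ pathVertices G A w
  symm := ⟨fun _ _ h => ⟨h.1.symm, h.2.2, h.2.1⟩⟩
  loopless := ⟨fun _ h => G.irrefl h.1⟩

/-- The vertices of that subtree that survive when its vertices of degree two, other than the
root `w`, are suppressed. -/
def keptVertices {V : Type*} (G : SimpleGraph V) (A : Set V) (w : V) : Set V :=
  {z | z ∈ pathVertices G A w ∧ (z = w ∨ ((pathTree G A w).neighborSet z).ncard ≠ 2)}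

/-- `x` and `y` are joined by a path of `H` that has no vertex of `K` in its interior. -/
def JoinedOutside {V : Type*} (H : SimpleGraph V) (K : Set V) (x y : V) : Prop :=
  ∃ p : H.Walk x y, p.IsPath ∧ ∀ z ∈ p.support, z ∈ K → z = x ∨ z = y

theorem JoinedOutside.symm {V : Type*} {H : SimpleGraph V} {K : Set V} {x y : V}
    (h : JoinedOutside H K x y) : JoinedOutside H K y x := by
  obtain ⟨p, hp, h⟩ := h
  refine ⟨p.reverse, hp.reverse, fun z hz hk => ?_⟩
  rw [SimpleGraph.Walk.support_reverse, List.mem_reverse] at hz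
  exact (h z hz hk).symm

/-- The subtree formed by the paths from `w` to the vertices of `A`, after its vertices of degree
two, other than the root `w`, are suppressed: two distinct kept vertices are adjacent if they are
joined by a path of the subtree with no kept vertex in its interior. -/
def suppressedTree {V : Type*} (G : SimpleGraph V) (A : Set V) (w : V) :
    SimpleGraph (keptVertices G A w) where
  Adj x y := x ≠ y ∧ JoinedOutside (pathTree G A w) (keptVertices G A w) x y
  symm := ⟨fun _ _ h => ⟨h.1.symm, h.2.symm⟩⟩
  loopless := ⟨fun _ h => h.1 rfl⟩

/-- An unrooted binary tree whose leaves are the elements of `L`: the leaves have degree one and the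
remaining, unlabelled, vertices have degree three. -/
structure UnrootedBinaryTree (L : Type) where
  k : ℕ
  graph : SimpleGraph (L ⊕ Fin k)
  isTree : graph.IsTree
  degree_leaf : ∀ x : L, (graph.neighborSet (Sum.inl x)).ncard = 1
  degree_inner : ∀ i : Fin k, (graph.neighborSet (Sum.inr i)).ncard = 3

open Classical in
/-- A rooted binary tree whose leaves are the elements of `L`: every non-leaf vertex has exactly two
children, so the root has degree two and the other non-leaf vertices have degree three. (The tree
that consists of a root alone, which is then its leaf, is included.) -/
structure RootedBinaryTree (L : Type) where
  k : ℕ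
  graph : SimpleGraph (L ⊕ Fin k)
  root : L ⊕ Fin k
  isTree : graph.IsTree
  degree_leaf : ∀ x : L, (graph.neighborSet (Sum.inl x)).ncard = if Sum.inl x = root then 0 else 1
  degree_inner : ∀ i : Fin k,
    (graph.neighborSet (Sum.inr i)).ncard = if Sum.inr i = root then 2 else 3

/-- Two unrooted trees are the same leaf-labelled tree if they are isomorphic by an isomorphism
that fixes every leaf. -/
instance unrootedSetoid (L : Type) : Setoid (UnrootedBinaryTree L) where
  r T T' := ∃ e : T.graph ≃g T'.graph, ∀ x : L, e (Sum.inl x) = Sum.inl x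
  iseqv :=
    { refl := fun _ => ⟨SimpleGraph.Iso.refl, fun _ => rfl⟩
      symm := fun ⟨e, h⟩ => ⟨e.symm, fun x => by
        conv_lhs => rw [← h x]
        exact e.symm_apply_apply _⟩
      trans := fun ⟨e, h⟩ ⟨f, g⟩ => ⟨e.trans f, fun x => by rw [RelIso.trans_apply, h x, g x]⟩ }

/-- Two rooted trees are the same leaf-labelled tree if they are isomorphic by an isomorphism
that fixes every leaf and maps the root to the root. -/
instance rootedSetoid (L : Type) : Setoid (RootedBinaryTree L) where
  r T T' := ∃ e : T.graph ≃g T'.graph, e T.root = T'.root ∧ ∀ x : L, e (Sum.inl x) = Sum.inl x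
  iseqv :=
    { refl := fun _ => ⟨SimpleGraph.Iso.refl, rfl, fun _ => rfl⟩
      symm := fun ⟨e, hr, h⟩ => ⟨e.symm, by rw [← hr, RelIso.symm_apply_apply],
        fun x => by
        conv_lhs => rw [← h x]
        exact e.symm_apply_apply _⟩
      trans := fun ⟨e, hr, h⟩ ⟨f, gr, g⟩ => ⟨e.trans f, by rw [RelIso.trans_apply, hr, gr],
        fun x => by rw [RelIso.trans_apply, h x, g x]⟩ }

/-- Unrooted leaf-labelled binary trees with leaf-set `L`. -/
abbrev UnrootedLabelledTree (L : Type) : Type := Quotient (unrootedSetoid L)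

/-- Rooted leaf-labelled binary trees with leaf-set `L`. -/
abbrev RootedLabelledTree (L : Type) : Type := Quotient (rootedSetoid L)

/-- Every set of unrooted trees is an event. -/
instance (L : Type) : MeasurableSpace (UnrootedLabelledTree L) := ⊤

/-- The set `S` of leaves induces the rooted tree `R` in the unrooted tree `T`, with reference leaf
`l` (a leaf outside `S`): for the vertex `v` adjacent to `l`, and for the first common vertex `w` of
the paths from `S` towards `v`, the tree formed by the paths from `w` to `S`, rooted at `w` and with
its other vertices of degree two suppressed, is `R`. -/
def UnrootedBinaryTree.Induces {L : Type} (T : UnrootedBinaryTree L) (l : L) (S : Finset L)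
    (R : RootedBinaryTree S) : Prop :=
  ∃ v w : L ⊕ Fin T.k, T.graph.Adj (Sum.inl l) v ∧
    IsFirstCommonVertex T.graph (Sum.inl '' (S : Set L)) v w ∧
    ∃ e : suppressedTree T.graph (Sum.inl '' (S : Set L)) w ≃g R.graph,
      (e.symm R.root : L ⊕ Fin T.k) = w ∧
      ∀ s : S, (e.symm (Sum.inl s) : L ⊕ Fin T.k) = Sum.inl (s : L)

theorem IsOnPath.map {V V' : Type*} {G : SimpleGraph V} {G' : SimpleGraph V'} (e : G ≃g G')
    {x y z : V} (h : IsOnPath G x y z) : IsOnPath G' (e x) (e y) (e z) := by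
  obtain ⟨p, hp, hz⟩ := h
  refine ⟨p.map e.toHom, hp.map e.injective, ?_⟩
  rw [SimpleGraph.Walk.support_map]
  exact List.mem_map_of_mem hz

theorem isOnPath_iso {V V' : Type*} {G : SimpleGraph V} {G' : SimpleGraph V'} (e : G ≃g G')
    {x y z : V} : IsOnPath G' (e x) (e y) (e z) ↔ IsOnPath G x y z :=
  ⟨fun h => by simpa using h.map e.symm, fun h => h.map e⟩

theorem IsFirstCommonVertex.map {V V' : Type*} {G : SimpleGraph V} {G' : SimpleGraph V'}
    (e : G ≃g G') {A : Set V} {v w : V} (h : IsFirstCommonVertex G A v w) :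
    IsFirstCommonVertex G' (e '' A) (e v) (e w) := by
  refine ⟨?_, fun u hu => ?_⟩
  · rintro _ ⟨x, hx, rfl⟩
    exact (h.1 x hx).map e
  · obtain ⟨u, rfl⟩ := e.surjective u
    exact (h.2 u fun x hx => (isOnPath_iso e).1 (hu _ ⟨x, hx, rfl⟩)).map e

theorem mem_pathVertices_iso {V V' : Type*} {G : SimpleGraph V} {G' : SimpleGraph V'}
    (e : G ≃g G') {A : Set V} {w z : V} :
    e z ∈ pathVertices G' (e '' A) (e w) ↔ z ∈ pathVertices G A w := by
  simp [pathVertices, isOnPath_iso e]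

/-- An isomorphism of graphs restricts to the subtrees formed by paths. -/
def pathTreeIso {V V' : Type*} {G : SimpleGraph V} {G' : SimpleGraph V'} (e : G ≃g G')
    (A : Set V) (w : V) : pathTree G A w ≃g pathTree G' (e '' A) (e w) where
  toEquiv := e.toEquiv
  map_rel_iff' := by
    intro x y
    exact and_congr e.map_rel_iff' (and_congr (mem_pathVertices_iso e) (mem_pathVertices_iso e))

theorem mem_keptVertices_iso {V V' : Type*} {G : SimpleGraph V} {G' : SimpleGraph V'}
    (e : G ≃g G') {A : Set V} {w z : V} :
    e z ∈ keptVertices G' (e '' A) (e w) ↔ z ∈ keptVertices G A w := by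
  have h : ((pathTree G' (e '' A) (e w)).neighborSet (e z)).ncard
      = ((pathTree G A w).neighborSet z).ncard :=
    (Nat.card_congr ((pathTreeIso e A w).mapNeighborSet z)).symm
  simp only [keptVertices, Set.mem_ofPred_eq, mem_pathVertices_iso e, h, e.injective.eq_iff]

theorem JoinedOutside.map {V V' : Type*} {H : SimpleGraph V} {H' : SimpleGraph V'} (f : H ≃g H')
    {K : Set V} {K' : Set V'} (hK : ∀ z, f z ∈ K' → z ∈ K) {x y : V} (h : JoinedOutside H K x y) :
    JoinedOutside H' K' (f x) (f y) := by
  obtain ⟨p, hp, h⟩ := h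
  refine ⟨p.map f.toHom, hp.map f.injective, fun z hz hk => ?_⟩
  rw [SimpleGraph.Walk.support_map, List.mem_map] at hz
  obtain ⟨z, hz, rfl⟩ := hz
  exact (h z hz (hK z hk)).imp (congrArg f) (congrArg f)

theorem joinedOutside_iso {V V' : Type*} {H : SimpleGraph V} {H' : SimpleGraph V'} (f : H ≃g H')
    {K : Set V} {K' : Set V'} (hK : ∀ z, f z ∈ K' ↔ z ∈ K) {x y : V} :
    JoinedOutside H' K' (f x) (f y) ↔ JoinedOutside H K x y := by
  refine ⟨fun h => ?_, fun h => h.map f fun z => (hK z).1⟩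
  have h2 := h.map f.symm (K' := K) fun z hz => by
    rw [← f.apply_symm_apply z]
    exact (hK _).2 hz
  rwa [f.symm_apply_apply, f.symm_apply_apply] at h2

/-- An isomorphism of graphs restricts to the trees that remain after suppression. -/
def suppressedTreeIso {V V' : Type*} {G : SimpleGraph V} {G' : SimpleGraph V'} (e : G ≃g G')
    (A : Set V) (w : V) : suppressedTree G A w ≃g suppressedTree G' (e '' A) (e w) where
  toEquiv := e.toEquiv.subtypeEquiv fun _ => (mem_keptVertices_iso e).symm
  map_rel_iff' := by
    intro x y
    exact and_congr (Equiv.injective _).ne_iff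
      (joinedOutside_iso (pathTreeIso e A w) fun _ => mem_keptVertices_iso e)

theorem UnrootedBinaryTree.Induces.congr {L : Type} {T T' : UnrootedBinaryTree L} {l : L}
    {S : Finset L} {R R' : RootedBinaryTree S} (hT : T ≈ T') (hR : R ≈ R')
    (h : T.Induces l S R) : T'.Induces l S R' := by
  obtain ⟨f, hf⟩ := hT
  obtain ⟨g, hgr, hg⟩ := hR
  obtain ⟨v, w, hv, hw, e, her, he⟩ := h
  have hA : f '' (Sum.inl '' (S : Set L)) = Sum.inl '' (S : Set L) := by
    rw [Set.image_image]
    exact Set.image_congr fun x _ => hf x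
  have hw' := hw.map f
  have key : ∃ e' : suppressedTree T'.graph (f '' (Sum.inl '' (S : Set L))) (f w) ≃g R'.graph,
      (e'.symm R'.root : L ⊕ Fin T'.k) = f w ∧
      ∀ s : S, (e'.symm (Sum.inl s) : L ⊕ Fin T'.k) = Sum.inl (s : L) := by
    refine ⟨((suppressedTreeIso f (Sum.inl '' (S : Set L)) w).symm.trans e).trans g, ?_, ?_⟩
    · have h1 : g.symm R'.root = R.root := by rw [← hgr, RelIso.symm_apply_apply]
      change f (e.symm (g.symm R'.root) : L ⊕ Fin T.k) = f w
      rw [h1, her]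
    · intro s
      have h1 : g.symm (Sum.inl s) = Sum.inl s := by
        conv_lhs => rw [← hg s]
        exact g.symm_apply_apply _
      change f (e.symm (g.symm (Sum.inl s)) : L ⊕ Fin T.k) = Sum.inl (s : L)
      rw [h1, he, hf]
  rw [hA] at hw' key
  refine ⟨f v, f w, ?_, hw', key⟩
  rw [← hf l]
  exact f.map_rel_iff.2 hv

/-- The set `S` of leaves induces the rooted leaf-labelled tree `R` in the unrooted leaf-labelled
tree `T`, with reference leaf `l`. -/
def UnrootedLabelledTree.Induces {L : Type} (T : UnrootedLabelledTree L) (l : L) (S : Finset L)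
    (R : RootedLabelledTree S) : Prop :=
  Quotient.liftOn₂ T R (fun T R => T.Induces l S R) fun _ _ _ _ hT hR =>
    propext ⟨fun h => h.congr hT hR, fun h => h.congr (Setoid.symm hT) (Setoid.symm hR)⟩

/-- The number of leaf-sets `S` with `a` elements that induce the same rooted tree in `T` and in
`T'`, where `ref S` is the reference leaf for `S`. -/
noncomputable def agreementCount {L : Type} (ref : Finset L → L) (a : ℕ) (T T' : UnrootedLabelledTree L) :
    ℕ :=
  {S : Finset L | S.card = a ∧
    ∃ R : RootedLabelledTree S, T.Induces (ref S) S R ∧ T'.Induces (ref S) S R}.ncard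

/-! Rooting an unrooted tree at the reference leaf `l` orders its vertices: `y` is above `x` when
`y` lies on the path from `x` to `l`. Each vertex has a cluster, the set of leaves below it. The
clusters of the vertices other than `l` form a binary hierarchy on the complement of `l`: a laminar
family containing the whole set and all singletons, in which each larger member is a disjoint union
of two members. This family determines the tree up to isomorphism
(`UnrootedBinaryTree.equiv_iff_clusters_eq`), and every hierarchy occurs
(`UnrootedBinaryTree.exists_clusters_eq`). Rooted trees on `S` correspond in the same way to
hierarchies on `S`.

In these terms, inducing is restriction: the induced tree on `S` has as clusters the nonempty traces
on `S` of the clusters of `T` (`UnrootedBinaryTree.induces_iff`). The vertices that survive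
suppression are those minimal for their trace.

It remains to count hierarchies on an `(n - 1)`-element set with a prescribed restriction to `S`.
Leaves are added one at a time. A hierarchy on `m` points has `2 m - 1` members, and an extension by
one point is given by the member above which the new leaf is attached
(`IsHierarchy.card_fiber_insert`). The product of `2 m - 1` for `m` from `a` to `n - 2` is `(2n-5)‼
/ (2a-3)‼`; this is `IsHierarchy.card_restrict_mul`. Starting from a single leaf, the same count
gives `(2n-5)‼` unrooted trees on `n` leaves and `(2a-3)‼` rooted trees on `S`.

Hence the tree induced by `S` in a uniform `T` is uniform among `(2a-3)‼` trees. Two independent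
copies agree on `S` with probability `1 / (2a-3)‼`, and linearity of expectation over the sets `S`
gives (ii). -/

/-! ### Tree orders and trees -/

/-- In the relation `le`, the element `y` covers `x`. -/
def Covers {V : Type*} (le : V → V → Prop) (x y : V) : Prop :=
  le x y ∧ x ≠ y ∧ ∀ z, le x z → le z y → z = x ∨ z = y

/-- A partial order with greatest element `r` in which the elements above any element form a
chain. -/
structure IsTreeOrder {V : Type*} (le : V → V → Prop) (r : V) : Prop where
  refl : ∀ x, le x x
  trans : ∀ {x y z}, le x y → le y z → le x z
  antisymm : ∀ {x y}, le x y → le y x → x = y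
  le_root : ∀ x, le x r
  chain : ∀ {x y z}, le x y → le x z → le y z ∨ le z y

/-- `G` is the Hasse diagram of the tree order `le` with root `r`. -/
structure IsHasse {V : Type*} (G : SimpleGraph V) (le : V → V → Prop) (r : V) : Prop
    extends IsTreeOrder le r where
  adj_iff : ∀ x y, G.Adj x y ↔ Covers le x y ∨ Covers le y x

/-! ### Paths towards a root, viewed as an order -/

section TreePaths

variable {V : Type*} {G : SimpleGraph V}

theorem isOnPath_iff_mem_support (hG : G.IsTree) {x y z : V} {p : G.Walk x y} (hp : p.IsPath) :
    IsOnPath G x y z ↔ z ∈ p.support := by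
  refine ⟨fun ⟨q, hq, hz⟩ => ?_, fun h => ⟨p, hp, h⟩⟩
  rwa [(hG.existsUnique_path x y).unique hp hq]

theorem isOnPath_start (hG : G.IsTree) (x y : V) : IsOnPath G x y x := by
  obtain ⟨p, hp, -⟩ := hG.existsUnique_path x y
  exact ⟨p, hp, p.start_mem_support⟩

theorem isOnPath_end (hG : G.IsTree) (x y : V) : IsOnPath G x y y := by
  obtain ⟨p, hp, -⟩ := hG.existsUnique_path x y
  exact ⟨p, hp, p.end_mem_support⟩

theorem IsOnPath.symm {x y z : V} (h : IsOnPath G x y z) : IsOnPath G y x z := by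
  obtain ⟨p, hp, hz⟩ := h
  exact ⟨p.reverse, hp.reverse, by simpa using hz⟩

/-- A path through `z` splits at `z`. -/
theorem IsOnPath.exists_append {x y z : V} (h : IsOnPath G x y z) :
    ∃ (p : G.Walk x z) (q : G.Walk z y), (p.append q).IsPath := by
  classical
  obtain ⟨p, hp, hz⟩ := h
  exact ⟨p.takeUntil z hz, p.dropUntil z hz, by rwa [p.take_spec hz]⟩

theorem isOnPath_trans (hG : G.IsTree) {r x y z : V} (h : IsOnPath G x r y)
    (h' : IsOnPath G y r z) : IsOnPath G x r z := by
  obtain ⟨p, q, hpq⟩ := h.exists_append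
  refine ⟨_, hpq, ?_⟩
  rw [SimpleGraph.Walk.mem_support_append_iff]
  exact Or.inr ((isOnPath_iff_mem_support hG hpq.of_append_right).1 h')

theorem isOnPath_antisymm (hG : G.IsTree) {r x y : V} (h : IsOnPath G x r y)
    (h' : IsOnPath G y r x) : x = y := by
  obtain ⟨p, q, hpq⟩ := h.exists_append
  obtain ⟨p', q', hpq'⟩ := h'.exists_append
  have h1 := (hG.existsUnique_path x r).unique hpq hpq'.of_append_right
  have h2 := (hG.existsUnique_path y r).unique hpq' hpq.of_append_right
  have h1 := congrArg SimpleGraph.Walk.length h1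
  have h2 := congrArg SimpleGraph.Walk.length h2
  rw [SimpleGraph.Walk.length_append] at h1 h2
  exact SimpleGraph.Walk.eq_of_length_eq_zero (p := p) (by omega)

theorem isOnPath_chain {r x y z : V} (h : IsOnPath G x r y) (hG : G.IsTree)
    (h' : IsOnPath G x r z) : IsOnPath G y r z ∨ IsOnPath G z r y := by
  obtain ⟨p, hp, hy⟩ := h
  rw [isOnPath_iff_mem_support hG hp] at h'
  induction p with
  | nil =>
    simp only [SimpleGraph.Walk.support_nil, List.mem_singleton] at hy h'
    subst hy h'
    exact Or.inl (isOnPath_start hG _ _)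
  | cons hadj q ih =>
    have hq := hp.of_cons
    rw [SimpleGraph.Walk.support_cons, List.mem_cons] at hy h'
    rcases hy with rfl | hy
    · exact Or.inl ⟨_, hp, by simpa using h'⟩
    rcases h' with rfl | h'
    · exact Or.inr ⟨_, hp, by simp [hy]⟩
    exact ih h' hq hy

theorem isTreeOrder_isOnPath (hG : G.IsTree) (r : V) :
    IsTreeOrder (fun x y => IsOnPath G x r y) r where
  refl x := isOnPath_start hG x r
  trans := isOnPath_trans hG
  antisymm := isOnPath_antisymm hG
  le_root x := isOnPath_end hG x r
  chain h h' := isOnPath_chain h hG h'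

/-- The path from a vertex to one of its ancestors consists of the vertices between the two. -/
theorem isOnPath_iff_of_isOnPath (hG : G.IsTree) {r x y z : V} (h : IsOnPath G x r y) :
    IsOnPath G x y z ↔ IsOnPath G x r z ∧ IsOnPath G z r y := by
  constructor
  · intro hz
    obtain ⟨p, q, hpq⟩ := h.exists_append
    obtain ⟨p1, p2, hp⟩ := hz.exists_append
    have hp12 := (hG.existsUnique_path x y).unique hp hpq.of_append_left
    rw [← hp12] at hpq
    refine ⟨⟨_, hpq, by simp⟩, ⟨p2.append q, ?_, by simp⟩⟩
    rw [← SimpleGraph.Walk.append_assoc] at hpq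
    exact hpq.of_append_right
  · rintro ⟨h1, h2⟩
    obtain ⟨p, q, hpq⟩ := h1.exists_append
    obtain ⟨q1, q2, hq⟩ := h2.exists_append
    have hq12 := (hG.existsUnique_path z r).unique hq hpq.of_append_right
    rw [← hq12, SimpleGraph.Walk.append_assoc] at hpq
    exact ⟨_, hpq.of_append_left, by simp⟩

/-- Neighbours are comparable: if `y` is off the path from `x` to `r`, prepending `y` to that path
gives the path from `y` to `r`. Conversely, the second vertex of the path from `x` through `y` lies
between `x` and `y`, so a cover is reached in one step. -/
theorem adj_iff_covers_isOnPath (hG : G.IsTree) (r x y : V) :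
    G.Adj x y ↔ Covers (fun x y => IsOnPath G x r y) x y ∨
      Covers (fun x y => IsOnPath G x r y) y x := by
  have key : ∀ x y, G.Adj x y → IsOnPath G x r y → Covers (fun x y => IsOnPath G x r y) x y := by
    intro x y hxy h
    refine ⟨h, hxy.ne, fun z h1 h2 => ?_⟩
    have h3 := (isOnPath_iff_of_isOnPath hG h).2 ⟨h1, h2⟩
    have hp : hxy.toWalk.IsPath := by simp [SimpleGraph.Walk.isPath_def, hxy.ne]
    simpa using (isOnPath_iff_mem_support hG hp).1 h3
  have key2 : ∀ x y, Covers (fun x y => IsOnPath G x r y) x y → G.Adj x y := by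
    rintro x y ⟨h, hne, hc⟩
    obtain ⟨p, q, hpq⟩ := h.exists_append
    cases p with
    | nil => exact absurd rfl hne
    | @cons _ u _ hadj p =>
      have h1 : IsOnPath G x r u := ⟨_, hpq, by simp⟩
      have h2 : IsOnPath G u r y := ⟨p.append q, hpq.of_cons, by simp⟩
      rcases hc u h1 h2 with rfl | rfl
      · exact absurd hadj (G.irrefl)
      · exact hadj
  refine ⟨fun hxy => ?_, fun h => h.elim (key2 x y) fun h => (key2 y x h).symm⟩
  obtain ⟨p, hp, -⟩ := hG.existsUnique_path x r
  by_cases hy : y ∈ p.support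
  · exact Or.inl (key x y hxy ⟨p, hp, hy⟩)
  · exact Or.inr (key y x hxy.symm ⟨p.cons hxy.symm, hp.cons hy, by simp⟩)

theorem isHasse_isOnPath (hG : G.IsTree) (r : V) :
    IsHasse G (fun x y => IsOnPath G x r y) r :=
  { isTreeOrder_isOnPath hG r with adj_iff := adj_iff_covers_isOnPath hG r }

end TreePaths

/-! ### Hasse diagrams of tree orders -/

section TreeOrders

variable {V : Type*} {G : SimpleGraph V} {le : V → V → Prop} {r : V}

theorem IsTreeOrder.covers_unique (h : IsTreeOrder le r) {x y z : V} (hy : Covers le x y)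
    (hz : Covers le x z) : y = z := by
  rcases h.chain hy.1 hz.1 with h1 | h1
  · exact (hz.2.2 y hy.1 h1).resolve_left hy.2.1.symm
  · exact ((hy.2.2 z hz.1 h1).resolve_left hz.2.1.symm).symm

/-- Induction from the root down. -/
theorem IsTreeOrder.induction [Finite V] (h : IsTreeOrder le r) {P : V → Prop}
    (step : ∀ x, (∀ y, le x y → y ≠ x → P y) → P x) (x : V) : P x := by
  have : IsTrans V (fun y x => le x y ∧ y ≠ x) :=
    ⟨fun a b c h1 h2 => ⟨h.trans h2.1 h1.1, by
      rintro rfl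
      exact h1.2 (h.antisymm h2.1 h1.1)⟩⟩
  have : Std.Irrefl (fun y x => le x y ∧ y ≠ x) := ⟨fun a h1 => h1.2 rfl⟩
  have wf : WellFounded (fun y x => le x y ∧ y ≠ x) := Finite.wellFounded_of_trans_of_irrefl _
  exact wf.induction x fun x ih => step x fun y h1 h2 => ih y ⟨h1, h2⟩

/-- Induction from the minimal elements up. -/
theorem IsTreeOrder.induction_up [Finite V] (h : IsTreeOrder le r) {P : V → Prop}
    (step : ∀ x, (∀ y, le y x → y ≠ x → P y) → P x) (x : V) : P x := by
  have : IsTrans V (fun y x => le y x ∧ y ≠ x) :=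
    ⟨fun a b c h1 h2 => ⟨h.trans h1.1 h2.1, by
      rintro rfl
      exact h1.2 (h.antisymm h1.1 h2.1)⟩⟩
  have : Std.Irrefl (fun y x => le y x ∧ y ≠ x) := ⟨fun a h1 => h1.2 rfl⟩
  have wf : WellFounded (fun y x => le y x ∧ y ≠ x) := Finite.wellFounded_of_trans_of_irrefl _
  exact wf.induction x fun x ih => step x fun y h1 h2 => ih y ⟨h1, h2⟩

/-- Every nonempty property has a minimal witness. -/
theorem IsTreeOrder.exists_minimal [Finite V] (h : IsTreeOrder le r) {P : V → Prop} {x : V}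
    (hx : P x) : ∃ y, P y ∧ le y x ∧ ∀ z, P z → le z y → z = y := by
  induction x using h.induction_up with
  | step x ih =>
    by_cases hc : ∃ y, P y ∧ le y x ∧ y ≠ x
    · obtain ⟨y, hy, hyx, hne⟩ := hc
      obtain ⟨z, hz, hzy, hm⟩ := ih y hyx hne hy
      exact ⟨z, hz, h.trans hzy hyx, hm⟩
    · push Not at hc
      exact ⟨x, hx, h.refl x, fun z hz hzx => hc z hz hzx⟩

/-- Between two comparable distinct elements there is one that covers the lower one. -/
theorem IsTreeOrder.exists_covers_le [Finite V] (h : IsTreeOrder le r) {x y : V} (hxy : le x y)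
    (hne : x ≠ y) : ∃ z, Covers le x z ∧ le z y := by
  obtain ⟨z, ⟨h1, h2⟩, h3, h4⟩ := h.exists_minimal (P := fun z => le x z ∧ x ≠ z) ⟨hxy, hne⟩
  refine ⟨z, ⟨h1, h2, fun u hu hu' => ?_⟩, h3⟩
  by_cases hux : u = x
  · exact Or.inl hux
  · exact Or.inr (h4 u ⟨hu, Ne.symm hux⟩ hu')

/-- Between two comparable distinct elements there is one that is covered by the upper one. -/
theorem IsTreeOrder.exists_le_covers [Finite V] (h : IsTreeOrder le r) {x y : V} (hxy : le x y)
    (hne : x ≠ y) : ∃ z, le x z ∧ Covers le z y := by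
  induction x using h.induction with
  | step x ih =>
    by_cases hc : ∃ u, le x u ∧ le u y ∧ u ≠ x ∧ u ≠ y
    · obtain ⟨u, h1, h2, h3, h4⟩ := hc
      obtain ⟨z, hz, hzy⟩ := ih u h1 h3 h2 h4
      exact ⟨z, h.trans h1 hz, hzy⟩
    · push Not at hc
      refine ⟨x, h.refl x, hxy, hne, fun z h1 h2 => ?_⟩
      by_cases h3 : z = x
      · exact Or.inl h3
      · exact Or.inr (hc z h1 h2 h3)

theorem IsHasse.exists_path [Finite V] (h : IsHasse G le r) (x : V) :
    ∃ p : G.Walk x r, p.IsPath ∧ ∀ z, z ∈ p.support ↔ le x z := by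
  induction x using h.toIsTreeOrder.induction with
  | step x ih =>
    by_cases hx : x = r
    · subst hx
      refine ⟨.nil, by simp, fun z => ?_⟩
      rw [SimpleGraph.Walk.support_nil, List.mem_singleton]
      exact ⟨by rintro rfl; exact h.refl z, fun hz => h.antisymm (h.le_root z) hz⟩
    · obtain ⟨y, hy, -⟩ := h.exists_covers_le (h.le_root x) hx
      obtain ⟨p, hp, hs⟩ := ih y hy.1 hy.2.1.symm
      refine ⟨p.cons ((h.adj_iff _ _).2 (Or.inl hy)), hp.cons ?_, fun z => ?_⟩
      · rw [hs]
        exact fun hyx => hy.2.1 (h.antisymm hy.1 hyx)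
      · rw [SimpleGraph.Walk.support_cons, List.mem_cons, hs]
        refine ⟨?_, fun hz => ?_⟩
        · rintro (rfl | hz)
          · exact h.refl z
          · exact h.trans hy.1 hz
        · rcases h.chain hy.1 hz with h1 | h1
          · exact Or.inr h1
          · rcases hy.2.2 z hz h1 with rfl | rfl
            · exact Or.inl rfl
            · exact Or.inr (h.refl z)

/-- Paths to the root give connectedness. Each vertex other than the root has a unique upper cover,
so sending it to the edge towards that cover is a bijection onto the edges, and there is one edge
fewer than there are vertices. -/
theorem IsHasse.isTree [Finite V] (h : IsHasse G le r) : G.IsTree := by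
  have hc : G.Connected := by
    have : Nonempty V := ⟨r⟩
    refine ⟨fun x y => ?_⟩
    obtain ⟨p, -⟩ := h.exists_path x
    obtain ⟨q, -⟩ := h.exists_path y
    exact ⟨p.append q.reverse⟩
  rw [SimpleGraph.isTree_iff_connected_and_card]
  refine ⟨hc, ?_⟩
  have hpar : ∀ x : {x // x ≠ r}, ∃ y, Covers le x y := fun x =>
    (h.exists_covers_le (h.le_root x) x.2).imp fun _ hy => hy.1
  choose par hpar using hpar
  have e : Nat.card {x // x ≠ r} = Nat.card G.edgeSet := by
    refine Nat.card_congr (Equiv.ofBijective (fun x => ⟨s(x.1, par x), ?_⟩) ⟨?_, ?_⟩)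
    · exact (h.adj_iff _ _).2 (Or.inl (hpar x))
    · intro x y hxy
      replace hxy : s(x.1, par x) = s(y.1, par y) := congrArg Subtype.val hxy
      rw [Sym2.eq_iff] at hxy
      rcases hxy with hxy | hxy
      · exact Subtype.ext hxy.1
      · have h1 := hpar x
        have h2 := hpar y
        rw [hxy.2] at h1
        rw [← hxy.1] at h2
        exact absurd (h.antisymm h1.1 h2.1) h1.2.1
    · rintro ⟨e, he⟩
      induction e with
      | _ x y =>
        have key : ∀ x y, Covers le x y → ∃ z, s(z.1, par z) = s(x, y) := by
          intro x y hxy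
          have hx : x ≠ r := by
            rintro rfl
            exact hxy.2.1 (h.antisymm hxy.1 (h.le_root y))
          exact ⟨⟨x, hx⟩, by rw [h.covers_unique hxy (hpar ⟨x, hx⟩)]⟩
        rcases (h.adj_iff x y).1 he with h1 | h1
        · obtain ⟨z, hz⟩ := key x y h1
          exact ⟨z, Subtype.ext hz⟩
        · obtain ⟨z, hz⟩ := key y x h1
          exact ⟨z, Subtype.ext (hz.trans Sym2.eq_swap)⟩
  have e2 : Nat.card {x // x ≠ r} + 1 = Nat.card V := by
    have h2 := Set.ncard_add_ncard_compl ({r}ᶜ : Set V)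
    rw [compl_compl, Set.ncard_singleton] at h2
    exact h2
  rw [← e, e2]

/-- Paths in a tree are unique, so the path built in `IsHasse.exists_path` is the only one. The
order can thus be read off from the graph, which is how the clusters of a constructed tree are
computed. -/
theorem IsHasse.isOnPath_iff [Finite V] (h : IsHasse G le r) {x z : V} :
    IsOnPath G x r z ↔ le x z := by
  obtain ⟨p, hp, hs⟩ := h.exists_path x
  rw [isOnPath_iff_mem_support h.isTree hp, hs]

theorem IsHasse.ncard_neighborSet_root (h : IsHasse G le r) :
    (G.neighborSet r).ncard = {y | Covers le y r}.ncard := by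
  congr 1
  ext y
  rw [SimpleGraph.mem_neighborSet, h.adj_iff]
  refine or_iff_right fun hc => hc.2.1 (h.antisymm hc.1 (h.le_root y))

theorem IsHasse.ncard_neighborSet [Finite V] (h : IsHasse G le r) {x : V} (hx : x ≠ r) :
    (G.neighborSet x).ncard = {y | Covers le y x}.ncard + 1 := by
  obtain ⟨p, hp, -⟩ := h.exists_covers_le (h.le_root x) hx
  have : G.neighborSet x = insert p {y | Covers le y x} := by
    ext y
    rw [SimpleGraph.mem_neighborSet, h.adj_iff, Set.mem_insert_iff]
    refine or_congr_left ⟨fun hy => h.covers_unique hy hp, ?_⟩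
    rintro rfl
    exact hp
  rw [this, Set.ncard_insert_of_notMem]
  exact fun hc => hc.2.1 (h.antisymm hc.1 hp.1)

/-- Every walk passes through the least common ancestor of its ends. -/
theorem IsHasse.exists_lub_mem_support (h : IsHasse G le r) {x y : V} (p : G.Walk x y) :
    ∃ m ∈ p.support, le x m ∧ le y m ∧ ∀ u, le x u → le y u → le m u := by
  induction p with
  | nil => exact ⟨_, by simp, h.refl _, h.refl _, fun u hu _ => hu⟩
  | @cons x x' y hadj q ih =>
    obtain ⟨m, hm, h1, h2, h3⟩ := ih
    by_cases hyx : le y x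
    · exact ⟨x, by simp, h.refl x, hyx, fun u hu _ => hu⟩
    refine ⟨m, by simp [hm], ?_⟩
    -- Since `x` is not above `y`, the vertices `x` and `x'` have the same common ancestors with
    -- `y`, whichever of the two covers the other.
    rcases (h.adj_iff _ _).1 hadj with hc | hc
    · refine ⟨h.trans hc.1 h1, h2, fun u hu hu' => ?_⟩
      rcases h.chain hc.1 hu with h4 | h4
      · exact h3 u h4 hu'
      · rcases hc.2.2 u hu h4 with rfl | rfl
        · exact absurd hu' hyx
        · exact h3 u h4 hu'
    · have hxm : le x m := by
        rcases h.chain hc.1 h1 with h4 | h4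
        · exact h4
        · exact absurd (h.trans h2 h4) hyx
      exact ⟨hxm, h2, fun u hu hu' => h3 u (h.trans hc.1 hu) hu'⟩

end TreeOrders

/-! ### Binary hierarchies -/

/-- `H` is the family of clusters of a rooted binary tree with leaf-set `X`. -/
structure IsHierarchy {α : Type*} (X : Set α) (H : Set (Set α)) : Prop where
  top_mem : X ∈ H
  subset : ∀ {A}, A ∈ H → A ⊆ X
  nonempty : ∀ {A}, A ∈ H → A.Nonempty
  singleton_mem : ∀ {x}, x ∈ X → {x} ∈ H
  laminar : ∀ {A B}, A ∈ H → B ∈ H → A ⊆ B ∨ B ⊆ A ∨ Disjoint A B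
  split : ∀ {A}, A ∈ H → (∃ x, A = {x}) ∨ ∃ B ∈ H, ∃ C ∈ H, Disjoint B C ∧ B ∪ C = A

/-- The nonempty traces on `S` of the members of `H`. -/
def restrictFamily {α : Type*} (S : Set α) (H : Set (Set α)) : Set (Set α) :=
  {D | D.Nonempty ∧ ∃ A ∈ H, A ∩ S = D}

/-- The hierarchy obtained by attaching a new leaf `x` on the edge above the cluster `C`. -/
def attachLeaf {α : Type*} (x : α) (C : Set α) (H : Set (Set α)) : Set (Set α) :=
  {A | A = {x} ∨ (A ∈ H ∧ ¬ C ⊂ A) ∨ ∃ D ∈ H, C ⊆ D ∧ A = insert x D}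

namespace IsHierarchy

variable {α : Type*} {X S : Set α} {H : Set (Set α)}

theorem restrictFamily_self (h : IsHierarchy X H) : restrictFamily X H = H := by
  ext D
  refine ⟨fun ⟨_, A, hA, hD⟩ => ?_, fun hD => ⟨h.nonempty hD, D, hD, ?_⟩⟩
  · rwa [← hD, Set.inter_eq_left.2 (h.subset hA)]
  · exact Set.inter_eq_left.2 (h.subset hD)

theorem exists_minimal [Finite α] {P : Set α → Prop} {A : Set α} (hA : P A) :
    ∃ B, P B ∧ ∀ C, P C → C ⊆ B → C = B := by
  obtain ⟨B, hB⟩ := (Set.toFinite {B | P B}).exists_minimal ⟨A, hA⟩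
  exact ⟨B, hB.1, fun C hC hCB => subset_antisymm hCB (hB.2 hC hCB)⟩

/-- Only the splitting needs an argument. A trace `D` may come from several members of `H`; for a
minimal one, both parts meet `S`, since otherwise the other part would be a smaller member with the
same trace. -/
theorem restrict [Finite α] (h : IsHierarchy X H) (hS : S.Nonempty) (hSX : S ⊆ X) :
    IsHierarchy S (restrictFamily S H) where
  top_mem := ⟨hS, X, h.top_mem, Set.inter_eq_right.2 hSX⟩
  subset := by
    rintro _ ⟨-, A, -, rfl⟩
    exact Set.inter_subset_right
  nonempty h := h.1
  singleton_mem {x} hx := ⟨Set.singleton_nonempty x, {x}, h.singleton_mem (hSX hx), by simpa⟩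
  laminar := by
    rintro _ _ ⟨-, A, hA, rfl⟩ ⟨-, B, hB, rfl⟩
    rcases h.laminar hA hB with h1 | h1 | h1
    · exact Or.inl (Set.inter_subset_inter_left _ h1)
    · exact Or.inr (Or.inl (Set.inter_subset_inter_left _ h1))
    · exact Or.inr (Or.inr (h1.mono Set.inter_subset_left Set.inter_subset_left))
  split := by
    rintro D ⟨hD, A, hA, hAD⟩
    obtain ⟨B, ⟨hB, hBD⟩, hmin⟩ := exists_minimal (P := fun A => A ∈ H ∧ A ∩ S = D) ⟨hA, hAD⟩
    rcases h.split hB with ⟨x, rfl⟩ | ⟨B1, h1, B2, h2, hd, rfl⟩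
    · left
      refine ⟨x, ?_⟩
      rw [← hBD] at hD ⊢
      obtain ⟨y, hy, hyS⟩ := hD
      rw [Set.mem_singleton_iff] at hy
      subst hy
      simpa using hyS
    · right
      rw [Set.union_inter_distrib_right] at hBD
      have key : ∀ B1 B2 : Set α, B1 ∈ H → B2 ∈ H → Disjoint B1 B2 → B1 ∩ S ∪ B2 ∩ S = D →
          (∀ C, C ∈ H ∧ C ∩ S = D → C ⊆ B1 ∪ B2 → C = B1 ∪ B2) → (B1 ∩ S).Nonempty := by
        intro B1 B2 h1 h2 hd hBD hmin
        rw [Set.nonempty_iff_ne_empty]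
        intro he
        rw [he, Set.empty_union] at hBD
        have h3 := hmin B2 ⟨h2, hBD⟩ Set.subset_union_right
        obtain ⟨x, hx⟩ := h.nonempty h1
        exact Set.disjoint_left.1 hd hx (h3 ▸ Or.inl hx)
      refine ⟨B1 ∩ S, ⟨key B1 B2 h1 h2 hd hBD hmin, B1, h1, rfl⟩,
        B2 ∩ S, ⟨key B2 B1 h2 h1 hd.symm ?_ ?_, B2, h2, rfl⟩,
        hd.mono Set.inter_subset_left Set.inter_subset_left, hBD⟩
      · rwa [Set.union_comm]
      · rwa [Set.union_comm]

theorem restrictFamily_restrictFamily {Y : Set α} (hSY : S ⊆ Y) :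
    restrictFamily S (restrictFamily Y H) = restrictFamily S H := by
  ext D
  constructor
  · rintro ⟨hD, _, ⟨-, A, hA, rfl⟩, rfl⟩
    exact ⟨hD, A, hA, by rw [Set.inter_assoc, Set.inter_eq_right.2 hSY]⟩
  · rintro ⟨hD, A, hA, rfl⟩
    refine ⟨hD, A ∩ Y, ⟨?_, A, hA, rfl⟩, by rw [Set.inter_assoc, Set.inter_eq_right.2 hSY]⟩
    exact hD.mono (Set.inter_subset_inter_right _ hSY)

/-- Members properly containing `C` survive only with `x` added, whereas `C` occurs both with and
without `x`: the set `insert x C` is the new inner vertex, with children `{x}` and `C`. -/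
theorem attach (h : IsHierarchy X H) {x : α} (hx : x ∉ X) {C : Set α} (hC : C ∈ H) :
    IsHierarchy (insert x X) (attachLeaf x C H) where
  top_mem := Or.inr (Or.inr ⟨X, h.top_mem, h.subset hC, rfl⟩)
  subset := by
    rintro A (rfl | ⟨hA, -⟩ | ⟨D, hD, -, rfl⟩)
    · simp
    · exact (h.subset hA).trans (Set.subset_insert _ _)
    · exact Set.insert_subset_insert (h.subset hD)
  nonempty := by
    rintro A (rfl | ⟨hA, -⟩ | ⟨D, hD, -, rfl⟩)
    · exact Set.singleton_nonempty x
    · exact h.nonempty hA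
    · exact Set.insert_nonempty _ _
  singleton_mem := by
    rintro y (rfl | hy)
    · exact Or.inl rfl
    · refine Or.inr (Or.inl ⟨h.singleton_mem hy, fun hc => ?_⟩)
      rw [Set.ssubset_singleton_iff] at hc
      exact (h.nonempty hC).ne_empty hc
  laminar := by
    have hxn : ∀ {A}, A ∈ H → x ∉ A := fun hA hxA => hx (h.subset hA hxA)
    have key : ∀ {A D}, A ∈ H → ¬ C ⊂ A → D ∈ H → C ⊆ D →
        A ⊆ insert x D ∨ Disjoint A (insert x D) := by
      intro A D hA hCA hD hCD
      rcases h.laminar hA hD with h1 | h1 | h1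
      · exact Or.inl (h1.trans (Set.subset_insert _ _))
      · left
        have h2 : C = A := by_contra fun hne => hCA ((hCD.trans h1).ssubset_of_ne hne)
        subst h2
        exact hCD.trans (Set.subset_insert _ _)
      · right
        rw [Set.disjoint_insert_right]
        exact ⟨hxn hA, h1⟩
    rintro A B (rfl | ⟨hA, hCA⟩ | ⟨D, hD, hCD, rfl⟩) (rfl | ⟨hB, hCB⟩ | ⟨E, hE, hCE, rfl⟩)
    · exact Or.inl subset_rfl
    · exact Or.inr (Or.inr (Set.disjoint_singleton_left.2 (hxn hB)))
    · exact Or.inl (by simp)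
    · exact Or.inr (Or.inr (Set.disjoint_singleton_right.2 (hxn hA)))
    · exact h.laminar hA hB
    · exact (key hA hCA hE hCE).imp_right Or.inr
    · exact Or.inr (Or.inl (by simp))
    · exact Or.inr ((key hB hCB hD hCD).imp_right fun h1 => h1.symm)
    · rcases h.laminar hD hE with h1 | h1 | h1
      · exact Or.inl (Set.insert_subset_insert h1)
      · exact Or.inr (Or.inl (Set.insert_subset_insert h1))
      · obtain ⟨y, hy⟩ := h.nonempty hC
        exact absurd (hCE hy) (Set.disjoint_left.1 h1 (hCD hy))
  split := by
    have hxn : ∀ {A}, A ∈ H → x ∉ A := fun hA hxA => hx (h.subset hA hxA)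
    have key : ∀ {B E}, B ∈ H → E ∈ H → Disjoint B E → C ⊆ B →
        ∃ B' ∈ attachLeaf x C H, ∃ E' ∈ attachLeaf x C H, Disjoint B' E' ∧
          B' ∪ E' = insert x (B ∪ E) := by
      intro B E hB hE hd hCB
      refine ⟨insert x B, Or.inr (Or.inr ⟨B, hB, hCB, rfl⟩), E, Or.inr (Or.inl ⟨hE, fun hc => ?_⟩),
        ?_, by rw [Set.insert_union]⟩
      · obtain ⟨y, hy⟩ := h.nonempty hC
        exact Set.disjoint_left.1 hd (hCB hy) (hc.1 hy)
      · rw [Set.disjoint_insert_left]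
        exact ⟨hxn hE, hd⟩
    rintro A (rfl | ⟨hA, hCA⟩ | ⟨D, hD, hCD, rfl⟩)
    · exact Or.inl ⟨x, rfl⟩
    · rcases h.split hA with h1 | ⟨B, hB, E, hE, hd, rfl⟩
      · exact Or.inl h1
      · refine Or.inr ⟨B, Or.inr (Or.inl ⟨hB, fun hc => hCA ?_⟩), E,
          Or.inr (Or.inl ⟨hE, fun hc => hCA ?_⟩), hd, rfl⟩
        · exact hc.trans_subset Set.subset_union_left
        · exact hc.trans_subset Set.subset_union_right
    · right
      -- If `D` is larger than `C`, then `C` lies in one of the two parts of `D`, and `x` joins that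
      -- part.
      by_cases hDC : C = D
      · subst hDC
        refine ⟨{x}, Or.inl rfl, C, Or.inr (Or.inl ⟨hC, fun hc => hc.ne rfl⟩), ?_,
          Set.singleton_union⟩
        exact Set.disjoint_singleton_left.2 (hxn hC)
      rcases h.split hD with ⟨y, rfl⟩ | ⟨B, hB, E, hE, hd, rfl⟩
      · exact absurd (((h.nonempty hC).subset_singleton_iff).1 hCD) hDC
      · have h1 : C ⊆ B ∨ C ⊆ E := by
          rcases h.laminar hC hB with h1 | h1 | h1
          · exact Or.inl h1
          · rcases h.laminar hC hE with h2 | h2 | h2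
            · exact Or.inr h2
            · exact absurd (subset_antisymm hCD (Set.union_subset h1 h2)) hDC
            · exact Or.inl (h2.subset_left_of_subset_union hCD)
          · exact Or.inr (h1.subset_right_of_subset_union hCD)
        rcases h1 with h1 | h1
        · exact key hB hE hd h1
        · rw [Set.union_comm]
          exact key hE hB hd.symm h1

theorem restrictFamily_attachLeaf (h : IsHierarchy X H) {x : α} (hx : x ∉ X) {C : Set α} :
    restrictFamily X (attachLeaf x C H) = H := by
  ext A
  constructor
  · rintro ⟨hne, B, rfl | ⟨hB, -⟩ | ⟨D, hD, -, rfl⟩, rfl⟩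
    · obtain ⟨y, rfl, hy⟩ := hne
      exact absurd hy hx
    · rwa [Set.inter_eq_left.2 (h.subset hB)]
    · rwa [Set.insert_inter_of_notMem hx, Set.inter_eq_left.2 (h.subset hD)]
  · intro hA
    refine ⟨h.nonempty hA, ?_⟩
    by_cases hc : C ⊆ A
    · refine ⟨insert x A, Or.inr (Or.inr ⟨A, hA, hc, rfl⟩), ?_⟩
      rw [Set.insert_inter_of_notMem hx, Set.inter_eq_left.2 (h.subset hA)]
    · exact ⟨A, Or.inr (Or.inl ⟨hA, fun h1 => hc h1.1⟩), Set.inter_eq_left.2 (h.subset hA)⟩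

/-- Every member of the form `insert x D` with `D` nonempty has `D` above the attachment point, and
`insert x C` is such a member. Used in both directions, this shows that the attachment point is
determined. -/
theorem attach_subset (h : IsHierarchy X H) {x : α} (hx : x ∉ X) {C C' : Set α} (hC : C ∈ H)
    (he : attachLeaf x C H = attachLeaf x C' H) : C' ⊆ C := by
  have h1 : insert x C ∈ attachLeaf x C' H := he ▸ Or.inr (Or.inr ⟨C, hC, subset_rfl, rfl⟩)
  have hxC : x ∉ C := fun hxC => hx (h.subset hC hxC)
  rcases h1 with h1 | ⟨h1, -⟩ | ⟨D, hD, hCD, h1⟩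
  · obtain ⟨y, hy⟩ := h.nonempty hC
    have : y ∈ ({x} : Set α) := h1 ▸ Or.inr hy
    rw [Set.mem_singleton_iff] at this
    exact absurd (this ▸ hy) hxC
  · exact absurd (h.subset h1 (Set.mem_insert x C)) hx
  · have hxD : x ∉ D := fun hxD => hx (h.subset hD hxD)
    have : C = D := by
      rw [← Set.insert_sdiff_self_of_notMem hxC, h1, Set.insert_sdiff_self_of_notMem hxD]
    rwa [this]

/-- The attachment point is the sibling of `x`. Let `M` be a minimal member containing `x` other
than `{x}`. The part of `M` that contains `x` is `{x}` by minimality, and the other part is `C`. -/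
theorem exists_attach [Finite α] {x : α} (hx : x ∉ X) (hX : X.Nonempty) {H' : Set (Set α)}
    (h' : IsHierarchy (insert x X) H') :
    ∃ C ∈ restrictFamily X H', attachLeaf x C (restrictFamily X H') = H' := by
  have htop : insert x X ≠ {x} := by
    obtain ⟨y, hy⟩ := hX
    intro he
    have : y ∈ ({x} : Set α) := he ▸ Or.inr hy
    rw [Set.mem_singleton_iff] at this
    exact hx (this ▸ hy)
  obtain ⟨M, ⟨hM, hxM, hMx⟩, hmin⟩ := exists_minimal
    (P := fun A => A ∈ H' ∧ x ∈ A ∧ A ≠ {x}) ⟨h'.top_mem, Set.mem_insert x X, htop⟩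
  obtain ⟨C, hC, hxC, rfl⟩ : ∃ C, C ∈ H' ∧ x ∉ C ∧ M = insert x C := by
    have key : ∀ {B E}, B ∈ H' → E ∈ H' → Disjoint B E → B ∪ E = M → x ∈ B →
        ∃ C, C ∈ H' ∧ x ∉ C ∧ M = insert x C := by
      rintro B E hB hE hd rfl hxB
      have hxE := Set.disjoint_left.1 hd hxB
      refine ⟨E, hE, hxE, ?_⟩
      by_cases h1 : B = {x}
      · rw [h1, Set.singleton_union]
      · have h2 := hmin B ⟨hB, hxB, h1⟩ Set.subset_union_left
        obtain ⟨y, hy⟩ := h'.nonempty hE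
        exact absurd hy (Set.disjoint_left.1 hd (h2 ▸ Or.inr hy))
    rcases h'.split hM with ⟨y, rfl⟩ | ⟨B, hB, E, hE, hd, hBE⟩
    · rw [Set.mem_singleton_iff] at hxM
      exact absurd (by rw [hxM]) hMx
    · rcases hBE ▸ hxM with h1 | h1
      · exact key hB hE hd hBE h1
      · exact key hE hB hd.symm (by rwa [Set.union_comm]) h1
  have hsub : ∀ {A}, A ∈ H' → x ∉ A → A ⊆ X := fun hA hxA =>
    (Set.subset_insert_iff_of_notMem hxA).1 (h'.subset hA)
  have hmem : ∀ {A}, A ∈ H' → x ∉ A → A ∈ restrictFamily X H' := fun hA hxA =>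
    ⟨h'.nonempty hA, _, hA, Set.inter_eq_left.2 (hsub hA hxA)⟩
  -- By laminarity, the minimal `M` is in fact the least member containing `x` other than `{x}`.
  have hbig : ∀ {A}, A ∈ H' → x ∈ A → A ≠ {x} → insert x C ⊆ A := by
    intro A hA hxA hne
    rcases h'.laminar hA hM with h1 | h1 | h1
    · rw [hmin A ⟨hA, hxA, hne⟩ h1]
    · exact h1
    · exact absurd (Set.mem_insert x C) (Set.disjoint_left.1 h1 hxA)
  have hins : ∀ {A}, A ∈ H' → x ∈ A → insert x (A ∩ X) = A := by
    intro A hA hxA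
    rw [Set.insert_inter_distrib, Set.insert_eq_of_mem hxA, Set.inter_eq_left.2 (h'.subset hA)]
  obtain ⟨c, hc⟩ := h'.nonempty hC
  refine ⟨C, hmem hC hxC, ?_⟩
  ext A
  constructor
  · rintro (rfl | ⟨⟨hne, B, hB, rfl⟩, hCA⟩ | ⟨_, ⟨hne, B, hB, rfl⟩, hCD, rfl⟩)
    · exact h'.singleton_mem (Set.mem_insert x X)
    · by_cases hxB : x ∈ B
      · have h1 : B ≠ {x} := by
          rintro rfl
          obtain ⟨y, rfl, hy⟩ := hne
          exact hx hy
        have h2 : C ⊆ B ∩ X :=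
          Set.subset_inter ((Set.subset_insert _ _).trans (hbig hB hxB h1)) (hsub hC hxC)
        have h3 : C = B ∩ X := by_contra fun h3 => hCA (h2.ssubset_of_ne h3)
        rwa [← h3]
      · rwa [Set.inter_eq_left.2 (hsub hB hxB)]
    · by_cases hxB : x ∈ B
      · rwa [hins hB hxB]
      · rw [Set.inter_eq_left.2 (hsub hB hxB)] at hCD ⊢
        rcases h'.laminar hB hM with h1 | h1 | h1
        · rw [Set.subset_insert_iff_of_notMem hxB] at h1
          rwa [subset_antisymm h1 hCD]
        · exact absurd (h1 (Set.mem_insert x C)) hxB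
        · exact absurd (Set.mem_insert_of_mem x hc) (Set.disjoint_left.1 h1 (hCD hc))
  · intro hA
    by_cases hxA : x ∈ A
    · by_cases h1 : A = {x}
      · exact Or.inl h1
      · have h2 : C ⊆ A ∩ X :=
          Set.subset_inter ((Set.subset_insert _ _).trans (hbig hA hxA h1)) (hsub hC hxC)
        exact Or.inr (Or.inr ⟨A ∩ X, ⟨⟨c, h2 hc⟩, A, hA, rfl⟩, h2, (hins hA hxA).symm⟩)
    · refine Or.inr (Or.inl ⟨hmem hA hxA, fun hCA => ?_⟩)
      rcases h'.laminar hA hM with h1 | h1 | h1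
      · rw [Set.subset_insert_iff_of_notMem hxA] at h1
        exact hCA.2 h1
      · exact hxA (h1 (Set.mem_insert x C))
      · exact Set.disjoint_left.1 h1 (hCA.1 hc) (Set.mem_insert_of_mem x hc)

/-- The members properly containing `C` are replaced one for one; the two additional members are
`{x}` and `insert x C`. -/
theorem ncard_attachLeaf [Finite α] (h : IsHierarchy X H) {x : α} (hx : x ∉ X) {C : Set α}
    (hC : C ∈ H) : (attachLeaf x C H).ncard = H.ncard + 2 := by
  have hxn : ∀ {A}, A ∈ H → x ∉ A := fun hA hxA => hx (h.subset hA hxA)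
  have h1 : attachLeaf x C H = insert {x} ((H \ {A | C ⊂ A}) ∪ insert x '' (H ∩ {A | C ⊆ A})) := by
    ext A
    simp only [attachLeaf, Set.mem_ofPred_eq, Set.mem_insert_iff, Set.mem_union, Set.mem_sdiff,
      Set.mem_image, Set.mem_inter_iff, and_assoc, eq_comm (a := A)]
  have h2 : H ∩ {A | C ⊆ A} = insert C (H ∩ {A | C ⊂ A}) := by
    ext A
    simp only [Set.mem_inter_iff, Set.mem_ofPred_eq, Set.mem_insert_iff]
    constructor
    · rintro ⟨hA, hCA⟩
      by_cases he : A = C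
      · exact Or.inl he
      · exact Or.inr ⟨hA, hCA.ssubset_of_ne (Ne.symm he)⟩
    · rintro (rfl | ⟨hA, hCA⟩)
      · exact ⟨hC, subset_rfl⟩
      · exact ⟨hA, hCA.1⟩
  have h3 : Set.InjOn (insert x) (H ∩ {A | C ⊆ A}) := by
    intro A hA B hB hAB
    rw [← Set.insert_sdiff_self_of_notMem (hxn hA.1), hAB,
      Set.insert_sdiff_self_of_notMem (hxn hB.1)]
  have h4 := Set.ncard_inter_add_ncard_sdiff_eq_ncard H {A | C ⊂ A}
  rw [h1, Set.ncard_insert_of_notMem, Set.ncard_union_eq, h3.ncard_image, h2,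
    Set.ncard_insert_of_notMem]
  · omega
  · exact fun hc => (show C ⊂ C from hc.2).ne rfl
  · rw [Set.disjoint_left]
    rintro _ hA ⟨D, -, rfl⟩
    exact hxn hA.1 (Set.mem_insert x D)
  · rintro (hA | ⟨D, hD, he⟩)
    · exact hxn hA.1 rfl
    · obtain ⟨y, hy⟩ := h.nonempty hD.1
      have h5 : y ∈ ({x} : Set α) := he ▸ Set.mem_insert_of_mem x hy
      rw [Set.mem_singleton_iff] at h5
      exact hxn hD.1 (h5 ▸ hy)

theorem eq_of_singleton {x : α} (h : IsHierarchy {x} H) : H = {{x}} := by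
  ext A
  refine ⟨fun hA => ((h.nonempty hA).subset_singleton_iff).1 (h.subset hA), ?_⟩
  rintro rfl
  exact h.top_mem

theorem isHierarchy_singleton (x : α) : IsHierarchy {x} {({x} : Set α)} where
  top_mem := rfl
  subset := by rintro _ rfl; rfl
  nonempty := by rintro _ rfl; exact Set.singleton_nonempty x
  singleton_mem := by rintro _ rfl; rfl
  laminar := by rintro _ _ rfl rfl; exact Or.inl subset_rfl
  split := by rintro _ rfl; exact Or.inl ⟨x, rfl⟩

/-- A rooted binary tree with `m` leaves has `2 m - 1` vertices. -/
theorem ncard_add_one [Finite α] (h : IsHierarchy X H) : H.ncard + 1 = 2 * X.ncard := by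
  induction X, Set.toFinite X using Set.Finite.induction_on generalizing H with
  | empty => exact absurd (h.nonempty h.top_mem) Set.not_nonempty_empty
  | @insert x X hx _ ih =>
    rcases X.eq_empty_or_nonempty with rfl | hX
    · rw [insert_empty_eq] at h ⊢
      rw [h.eq_of_singleton, Set.ncard_singleton, Set.ncard_singleton]
    · obtain ⟨C, hC, he⟩ := exists_attach hx hX h
      have h1 := h.restrict hX (Set.subset_insert x X)
      rw [← he, h1.ncard_attachLeaf hx hC, Set.ncard_insert_of_notMem hx]
      have := ih h1
      omega

/-- There are as many ways of attaching a new leaf as there are clusters. -/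
theorem card_fiber_insert [Finite α] (h : IsHierarchy X H) {x : α} (hx : x ∉ X) :
    Nat.card {H' // IsHierarchy (insert x X) H' ∧ restrictFamily X H' = H} = H.ncard := by
  symm
  refine Nat.card_congr (Equiv.ofBijective
    (fun C : H => ⟨attachLeaf x C H, h.attach hx C.2, h.restrictFamily_attachLeaf hx⟩) ⟨?_, ?_⟩)
  · intro C C' he
    replace he : attachLeaf x C.1 H = attachLeaf x C'.1 H := congrArg Subtype.val he
    exact Subtype.ext (subset_antisymm (h.attach_subset hx C'.2 he.symm)
      (h.attach_subset hx C.2 he))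
  · rintro ⟨H', h', rfl⟩
    obtain ⟨C, hC, he⟩ := exists_attach hx (h.nonempty h.top_mem) h'
    exact ⟨⟨C, hC⟩, Subtype.ext he⟩

/-- The number of hierarchies on `X` with a given restriction to `S`. -/
theorem card_restrict_mul [Finite α] {H₀ : Set (Set α)} (h₀ : IsHierarchy S H₀) (hSX : S ⊆ X) :
    Nat.card {H // IsHierarchy X H ∧ restrictFamily S H = H₀} * (2 * S.ncard - 3)‼
      = (2 * X.ncard - 3)‼ := by
  have hS := h₀.nonempty h₀.top_mem
  obtain ⟨Y, rfl⟩ : ∃ Y, X = S ∪ Y := ⟨X, (Set.union_eq_right.2 hSX).symm⟩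
  clear hSX
  induction Y, Set.toFinite Y using Set.Finite.induction_on with
  | empty =>
    rw [Set.union_empty]
    have : Unique {H // IsHierarchy S H ∧ restrictFamily S H = H₀} :=
      { default := ⟨H₀, h₀, h₀.restrictFamily_self⟩
        uniq := fun ⟨H, h, he⟩ => Subtype.ext (h.restrictFamily_self.symm.trans he) }
    rw [Nat.card_unique, one_mul]
  | @insert x Y _ _ ih =>
    rw [Set.union_insert]
    by_cases hx : x ∈ S ∪ Y
    · rwa [Set.insert_eq_of_mem hx]
    have e : {H // IsHierarchy (insert x (S ∪ Y)) H ∧ restrictFamily S H = H₀} ≃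
        Σ H : {H // IsHierarchy (S ∪ Y) H ∧ restrictFamily S H = H₀},
          {H' // IsHierarchy (insert x (S ∪ Y)) H' ∧ restrictFamily (S ∪ Y) H' = H.1} :=
      { toFun := fun H => ⟨⟨restrictFamily (S ∪ Y) H.1,
          H.2.1.restrict (hS.mono Set.subset_union_left) (Set.subset_insert _ _), by
            rw [restrictFamily_restrictFamily Set.subset_union_left, H.2.2]⟩, ⟨H.1, H.2.1, rfl⟩⟩
        invFun := fun p => ⟨p.2.1, p.2.2.1, by
          have h1 := p.1.2.2
          rwa [← p.2.2.2, restrictFamily_restrictFamily Set.subset_union_left] at h1⟩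
        left_inv := fun H => rfl
        right_inv := by
          rintro ⟨⟨H, h⟩, ⟨H', h', he⟩⟩
          dsimp only at he
          subst he
          rfl }
    have hc : ∀ H : {H // IsHierarchy (S ∪ Y) H ∧ restrictFamily S H = H₀},
        Nat.card {H' // IsHierarchy (insert x (S ∪ Y)) H' ∧ restrictFamily (S ∪ Y) H' = H.1}
          = 2 * (S ∪ Y).ncard - 1 := by
      intro H
      rw [H.2.1.card_fiber_insert hx]
      have := H.2.1.ncard_add_one
      omega
    have hpos : 0 < (S ∪ Y).ncard :=
      (Set.ncard_pos (Set.toFinite _)).2 (hS.mono Set.subset_union_left)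
    have := Fintype.ofFinite {H // IsHierarchy (S ∪ Y) H ∧ restrictFamily S H = H₀}
    rw [Nat.card_congr e, Nat.card_sigma, Finset.sum_congr rfl fun H _ => hc H, Finset.sum_const,
      Finset.card_univ, ← Nat.card_eq_fintype_card, smul_eq_mul, mul_right_comm, ih,
      Set.ncard_insert_of_notMem hx]
    generalize (S ∪ Y).ncard = m at hpos
    -- The recursion `(2m - 1)‼ = (2m - 1) * (2m - 3)‼` needs `m ≥ 2`. For `m = 1` the truncated
    -- difference `2 * 1 - 3` is `0`, and `0‼ = 1` is the correct value.
    obtain rfl | ⟨k, rfl⟩ : m = 1 ∨ ∃ k, m = k + 2 := by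
      rcases m with _ | _ | k
      · omega
      · exact Or.inl rfl
      · exact Or.inr ⟨k, rfl⟩
    · rfl
    · rw [show 2 * (k + 2 + 1) - 3 = (2 * (k + 2) - 3) + 2 by omega, Nat.doubleFactorial_add_two,
        mul_comm]
      congr 1

/-- The number of rooted binary trees with leaf-set `X`. -/
theorem card_isHierarchy [Finite α] (hX : X.Nonempty) :
    Nat.card {H // IsHierarchy X H} = (2 * X.ncard - 3)‼ := by
  obtain ⟨x, hx⟩ := hX
  have hx' : {x} ⊆ X := Set.singleton_subset_iff.2 hx
  have h := card_restrict_mul (isHierarchy_singleton x) hx'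
  -- Here `2 * 1 - 3` is `0` by truncation, so the factor is `0‼ = 1`; prescribing the restriction
  -- to one point is no condition.
  rw [Set.ncard_singleton, Nat.doubleFactorial, mul_one] at h
  rw [← h]
  refine Nat.card_congr (Equiv.subtypeEquivRight fun H => (and_iff_left_of_imp fun hH => ?_).symm)
  exact (hH.restrict (Set.singleton_nonempty x) hx').eq_of_singleton

end IsHierarchy

/-! ### Clusters of a tree -/

/-- The labels of the leaves below `z`, where the leaf `f i` has the label `g i`. -/
def cluster {V ι α : Type*} (le : V → V → Prop) (f : ι → V) (g : ι → α) (z : V) : Set α :=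
  g '' {i | le (f i) z}

/-- A rooted tree with leaves `f i` that is determined by its clusters. -/
structure IsLeafTree {V ι : Type*} (G : SimpleGraph V) (le : V → V → Prop) (r : V) (f : ι → V) :
    Prop extends IsHasse G le r where
  exists_leaf : ∀ z, ∃ i, le (f i) z
  exists_leaf_of_covers : ∀ {x y}, Covers le x y → ∃ i, le (f i) y ∧ ¬ le (f i) x

section Clusters

variable {V ι α : Type*} {G : SimpleGraph V} {le : V → V → Prop} {r : V} {f : ι → V} {g : ι → α}

theorem mem_cluster (hg : g.Injective) {i : ι} {z : V} :
    g i ∈ cluster le f g z ↔ le (f i) z := by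
  simp [cluster, hg.eq_iff]

theorem IsTreeOrder.cluster_mono (h : IsTreeOrder le r) {x y : V} (hxy : le x y) :
    cluster le f g x ⊆ cluster le f g y :=
  Set.image_mono fun _ hi => h.trans hi hxy

theorem IsTreeOrder.cluster_root (h : IsTreeOrder le r) : cluster le f g r = Set.range g := by
  rw [cluster, ← Set.image_univ]
  congr 1
  ext i
  simp [h.le_root]

theorem IsTreeOrder.cluster_laminar (h : IsTreeOrder le r) (hg : g.Injective) (x y : V) :
    cluster le f g x ⊆ cluster le f g y ∨ cluster le f g y ⊆ cluster le f g x ∨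
      Disjoint (cluster le f g x) (cluster le f g y) := by
  by_cases hc : le x y ∨ le y x
  · exact hc.elim (fun h1 => Or.inl (h.cluster_mono h1))
      fun h1 => Or.inr (Or.inl (h.cluster_mono h1))
  · refine Or.inr (Or.inr (Set.disjoint_left.2 ?_))
    rintro _ ⟨i, hi, rfl⟩ hi'
    exact hc (h.chain hi ((mem_cluster hg).1 hi'))

theorem not_le_of_covers {b c z : V} (hb : Covers le b z)
    (hc : Covers le c z) (hne : b ≠ c) : ¬ le b c := fun hbc =>
  (hb.2.2 c hbc hc.1).elim (fun h1 => hne h1.symm) hc.2.1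

theorem IsTreeOrder.disjoint_cluster (h : IsTreeOrder le r) (hg : g.Injective) {b c z : V}
    (hb : Covers le b z) (hc : Covers le c z) (hne : b ≠ c) :
    Disjoint (cluster le f g b) (cluster le f g c) := by
  refine Set.disjoint_left.2 ?_
  rintro _ ⟨i, hi, rfl⟩ hi'
  rcases h.chain hi ((mem_cluster hg).1 hi') with h1 | h1
  · exact not_le_of_covers hb hc hne h1
  · exact not_le_of_covers hc hb hne.symm h1

theorem IsTreeOrder.cluster_split [Finite V] (h : IsTreeOrder le r) (hg : g.Injective) {z : V}
    (hz : z ∉ Set.range f) (h2 : {c | Covers le c z}.ncard = 2) :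
    ∃ b c, Covers le b z ∧ Covers le c z ∧ Disjoint (cluster le f g b) (cluster le f g c) ∧
      cluster le f g b ∪ cluster le f g c = cluster le f g z := by
  obtain ⟨b, c, hne, hbc⟩ := Set.ncard_eq_two.1 h2
  have hmem : ∀ u, Covers le u z ↔ u = b ∨ u = c := fun u => by
    have : u ∈ {c | Covers le c z} ↔ u ∈ ({b, c} : Set V) := by rw [hbc]
    simpa using this
  have hb := (hmem b).2 (Or.inl rfl)
  have hc := (hmem c).2 (Or.inr rfl)
  refine ⟨b, c, hb, hc, h.disjoint_cluster hg hb hc hne, subset_antisymm ?_ ?_⟩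
  · exact Set.union_subset (h.cluster_mono hb.1) (h.cluster_mono hc.1)
  · rintro _ ⟨i, hi, rfl⟩
    obtain ⟨u, h1, h2⟩ := h.exists_le_covers hi fun he => hz ⟨i, he⟩
    rcases (hmem u).1 h2 with rfl | rfl
    · exact Or.inl ⟨i, h1, rfl⟩
    · exact Or.inr ⟨i, h1, rfl⟩

theorem IsTreeOrder.cluster_leaf [Finite V] (h : IsTreeOrder le r) (hf : f.Injective) {i : ι}
    (hi : {c | Covers le c (f i)}.ncard = 0) : cluster le f g (f i) = {g i} := by
  rw [cluster, ← Set.image_singleton]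
  congr 1
  ext j
  refine ⟨fun hj => ?_, by rintro rfl; exact h.refl _⟩
  by_contra hne
  obtain ⟨u, -, hu⟩ := h.exists_le_covers hj (hf.ne hne)
  rw [Set.ncard_eq_zero (Set.toFinite _)] at hi
  exact Set.notMem_empty u (hi ▸ hu)

/-- Descending through children reaches a leaf from every vertex. If `y` covers `x` and is not
itself a leaf, a leaf below the other child of `y` separates the two clusters. -/
theorem IsHasse.isLeafTree [Finite V] (h : IsHasse G le r)
    (h2 : ∀ z, z ∉ Set.range f → {c | Covers le c z}.ncard = 2) : IsLeafTree G le r f := by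
  have hl : ∀ z, ∃ i, le (f i) z := by
    intro z
    induction z using h.toIsTreeOrder.induction_up with
    | step z ih =>
      by_cases hz : z ∈ Set.range f
      · obtain ⟨i, rfl⟩ := hz
        exact ⟨i, h.refl _⟩
      · obtain ⟨b, hb⟩ := (Set.ncard_pos (Set.toFinite _)).1 (h2 z hz ▸ Nat.two_pos)
        obtain ⟨i, hi⟩ := ih b hb.1 hb.2.1
        exact ⟨i, h.trans hi hb.1⟩
  refine { h with exists_leaf := hl, exists_leaf_of_covers := fun {x y} hxy => ?_ }
  by_cases hy : y ∈ Set.range f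
  · obtain ⟨i, rfl⟩ := hy
    exact ⟨i, h.refl _, fun hc => hxy.2.1 (h.antisymm hxy.1 hc)⟩
  · obtain ⟨x', hx', hne⟩ := Set.exists_ne_of_one_lt_ncard ((h2 y hy).symm ▸ Nat.one_lt_two) x
    obtain ⟨i, hi⟩ := hl x'
    refine ⟨i, h.trans hi hx'.1, fun hc => ?_⟩
    rcases h.chain hc hi with h1 | h1
    · exact not_le_of_covers hxy hx' hne.symm h1
    · exact not_le_of_covers hx' hxy hne h1

/-- A leaf below `x` is also below `y`, so the two are comparable. If `y` were strictly below `x`,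
it would lie below some `u` covered by `x`, and a leaf below `x` but not below `u` would be missing
from the cluster of `y`. -/
theorem IsLeafTree.cluster_subset_iff [Finite V] (h : IsLeafTree G le r f) (hg : g.Injective)
    {x y : V} : cluster le f g x ⊆ cluster le f g y ↔ le x y := by
  refine ⟨fun hxy => ?_, h.cluster_mono⟩
  obtain ⟨i, hi⟩ := h.exists_leaf x
  have hi' : le (f i) y := (mem_cluster hg).1 (hxy ⟨i, hi, rfl⟩)
  rcases h.chain hi hi' with h1 | h1
  · exact h1
  · by_contra hn
    obtain ⟨u, hyu, hu⟩ := h.exists_le_covers h1 (by rintro rfl; exact hn h1)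
    obtain ⟨j, hj, hj'⟩ := h.exists_leaf_of_covers hu
    exact hj' (h.trans ((mem_cluster hg).1 (hxy ⟨j, hj, rfl⟩)) hyu)

theorem IsLeafTree.cluster_injective [Finite V] (h : IsLeafTree G le r f) (hg : g.Injective) :
    (cluster le f g).Injective := fun _ _ he =>
  h.antisymm ((h.cluster_subset_iff hg).1 he.subset) ((h.cluster_subset_iff hg).1 he.superset)

/-- Trees with the same clusters are isomorphic. -/
theorem IsLeafTree.exists_iso {V' : Type*} [Finite V] [Finite V'] {G' : SimpleGraph V'}
    {le' : V' → V' → Prop} {r' : V'} {f' : ι → V'} (h : IsLeafTree G le r f)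
    (h' : IsLeafTree G' le' r' f') (hg : g.Injective)
    (hr : Set.range (cluster le f g) = Set.range (cluster le' f' g))
    (hf : ∀ i, cluster le f g (f i) = cluster le' f' g (f' i)) :
    ∃ e : G ≃g G', e r = r' ∧ ∀ i, e (f i) = f' i := by
  let e : V ≃ V' := (Equiv.ofInjective _ (h.cluster_injective hg)).trans
    ((Equiv.setCongr hr).trans (Equiv.ofInjective _ (h'.cluster_injective hg)).symm)
  have he : ∀ z, cluster le' f' g (e z) = cluster le f g z := fun z =>
    Equiv.apply_ofInjective_symm (h'.cluster_injective hg) _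
  have hle : ∀ x y, le' (e x) (e y) ↔ le x y := fun x y => by
    rw [← h'.cluster_subset_iff hg, he, he, h.cluster_subset_iff hg]
  have hcov : ∀ x y, Covers le' (e x) (e y) ↔ Covers le x y := fun x y => by
    simp only [Covers, hle, e.injective.ne_iff, e.surjective.forall, e.injective.eq_iff]
  refine ⟨⟨e, fun {x y} => ?_⟩, ?_, fun i => ?_⟩
  · rw [h.adj_iff, h'.adj_iff, hcov, hcov]
  · refine h'.cluster_injective hg ((he r).trans ?_)
    rw [h.cluster_root, h'.cluster_root]
  · exact h'.cluster_injective hg ((he (f i)).trans (hf i))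

/-- Isomorphic trees have the same clusters. -/
theorem range_cluster_iso {V' : Type*} {G' : SimpleGraph V'} {r' : V'} {f' : ι → V'} (e : G ≃g G')
    (hr : e r = r') (hf : ∀ i, e (f i) = f' i) :
    Set.range (cluster (fun x y => IsOnPath G' x r' y) f' g)
      = Set.range (cluster (fun x y => IsOnPath G x r y) f g) := by
  have : cluster (fun x y => IsOnPath G x r y) f g
      = cluster (fun x y => IsOnPath G' x r' y) f' g ∘ e := by
    funext z
    simp only [cluster, Function.comp_apply, ← hr, ← hf, isOnPath_iso e]
  rw [this, e.surjective.range_comp]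

/-- The cut-off `t` lets one argument serve both kinds of trees: `t` is the root of a rooted tree,
or the neighbour of the reference leaf in an unrooted one. -/
theorem IsLeafTree.isHierarchy [Finite V] (h : IsLeafTree G le r f) (hf : f.Injective)
    (hg : g.Injective) (t : V) (hin : ∀ z, z ∉ Set.range f → {c | Covers le c z}.ncard = 2)
    (hleaf : ∀ i, le (f i) t → {c | Covers le c (f i)}.ncard = 0) :
    IsHierarchy (cluster le f g t) {A | ∃ z, le z t ∧ cluster le f g z = A} where
  top_mem := ⟨t, h.refl t, rfl⟩
  subset := by
    rintro _ ⟨z, hz, rfl⟩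
    exact h.cluster_mono hz
  nonempty := by
    rintro _ ⟨z, -, rfl⟩
    obtain ⟨i, hi⟩ := h.exists_leaf z
    exact ⟨g i, i, hi, rfl⟩
  singleton_mem := by
    rintro _ ⟨i, hi, rfl⟩
    exact ⟨f i, hi, h.cluster_leaf hf (hleaf i hi)⟩
  laminar := by
    rintro _ _ ⟨x, -, rfl⟩ ⟨y, -, rfl⟩
    exact h.cluster_laminar hg x y
  split := by
    rintro _ ⟨z, hz, rfl⟩
    by_cases hzf : z ∈ Set.range f
    · obtain ⟨i, rfl⟩ := hzf
      exact Or.inl ⟨g i, h.cluster_leaf hf (hleaf i hz)⟩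
    · obtain ⟨b, c, hb, hc, hd, hu⟩ := h.cluster_split hg hzf (hin z hzf)
      exact Or.inr ⟨_, ⟨b, h.trans hb.1 hz, rfl⟩, _, ⟨c, h.trans hc.1 hz, rfl⟩, hd, hu⟩

end Clusters

/-! ### Trees with given clusters -/

/-- The Hasse diagram of an order relation. -/
def hasseGraph {V : Type*} (le : V → V → Prop) : SimpleGraph V where
  Adj x y := Covers le x y ∨ Covers le y x
  symm := ⟨fun _ _ h => h.symm⟩
  loopless := ⟨fun _ h => h.elim (fun h => h.2.1 rfl) fun h => h.2.1 rfl⟩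

/-- The vertices of a tree, ordered by inclusion of the clusters that `e` assigns to them. -/
def clusterLE {V α : Type*} {W : Set (Set α)} (e : V ≃ W) (x y : V) : Prop :=
  (e x : Set α) ⊆ e y

section Realization

variable {V α : Type*} {W : Set (Set α)} {R : Set α}

theorem isHasse_hasseGraph (hsub : ∀ A ∈ W, A ⊆ R) (hne : ∀ A ∈ W, A.Nonempty)
    (hlam : ∀ A ∈ W, ∀ B ∈ W, A ⊆ B ∨ B ⊆ A ∨ Disjoint A B) (e : V ≃ W) {r : V}
    (hr : (e r : Set α) = R) : IsHasse (hasseGraph (clusterLE e)) (clusterLE e) r where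
  refl _ := subset_rfl
  trans h h' := h.trans h'
  antisymm h h' := e.injective (Subtype.ext (subset_antisymm h h'))
  le_root x := by
    unfold clusterLE
    rw [hr]
    exact hsub _ (e x).2
  chain {x y z} h h' := by
    rcases hlam _ (e y).2 _ (e z).2 with h1 | h1 | h1
    · exact Or.inl h1
    · exact Or.inr h1
    · obtain ⟨a, ha⟩ := hne _ (e x).2
      exact absurd (h' ha) (Set.disjoint_left.1 h1 (h ha))
  adj_iff _ _ := Iff.rfl

theorem ncard_covers_of_singleton (hne : ∀ A ∈ W, A.Nonempty) (e : V ≃ W) {z : V} {x : α}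
    (hz : (e z : Set α) = {x}) : {c | Covers (clusterLE e) c z}.ncard = 0 := by
  convert Set.ncard_empty V
  rw [Set.eq_empty_iff_forall_notMem]
  rintro c ⟨h1, h2, -⟩
  unfold clusterLE at h1
  rw [hz, (hne _ (e c).2).subset_singleton_iff, ← hz] at h1
  exact h2 (e.injective (Subtype.ext h1))

/-- By laminarity, a member of `W` between `B` and `B ∪ C` either contains `C` or is disjoint from
it, so it is one of the two ends. Any other member inside `B ∪ C` is comparable to `B` or lies in
`C`, which excludes further covers. -/
theorem ncard_covers_of_union (hne : ∀ A ∈ W, A.Nonempty)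
    (hlam : ∀ A ∈ W, ∀ B ∈ W, A ⊆ B ∨ B ⊆ A ∨ Disjoint A B) (e : V ≃ W) {z : V} {B C : Set α}
    (hB : B ∈ W) (hC : C ∈ W) (hd : Disjoint B C) (hz : B ∪ C = e z) :
    {c | Covers (clusterLE e) c z}.ncard = 2 := by
  obtain ⟨b, hb⟩ := e.surjective ⟨B, hB⟩
  obtain ⟨c, hc⟩ := e.surjective ⟨C, hC⟩
  have hb : (e b : Set α) = B := by rw [hb]
  have hc : (e c : Set α) = C := by rw [hc]
  subst hb hc
  have key : ∀ b c, Disjoint (e b : Set α) (e c) → (e b : Set α) ∪ e c = e z →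
      Covers (clusterLE e) b z := by
    intro b c hd hz
    have hcn := hne _ (e c).2
    refine ⟨Set.subset_union_left.trans hz.subset, ?_, fun y hy hyz => ?_⟩
    · rintro rfl
      obtain ⟨x, hx⟩ := hcn
      exact Set.disjoint_left.1 hd (hz ▸ Or.inr hx) hx
    · unfold clusterLE at hy hyz
      rw [← hz] at hyz
      rcases hlam _ (e y).2 _ (e c).2 with h1 | h1 | h1
      · obtain ⟨x, hx⟩ := hne _ (e b).2
        exact absurd (h1 (hy hx)) (Set.disjoint_left.1 hd hx)
      · right
        refine e.injective (Subtype.ext ?_)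
        rw [← hz]
        exact subset_antisymm hyz (Set.union_subset hy h1)
      · left
        exact e.injective (Subtype.ext (subset_antisymm (h1.subset_left_of_subset_union hyz) hy))
  have hcov : {u | Covers (clusterLE e) u z} = {b, c} := by
    have hb' := key b c hd hz
    have hc' := key c b hd.symm (by rwa [Set.union_comm])
    ext u
    simp only [Set.mem_ofPred_eq, Set.mem_insert_iff, Set.mem_singleton_iff]
    refine ⟨fun hu => ?_, by rintro (rfl | rfl) <;> assumption⟩
    have huz : (e u : Set α) ⊆ e b ∪ e c := by
      rw [hz]
      exact hu.1
    have hle : ∀ v, Covers (clusterLE e) v z → (e u : Set α) ⊆ e v → u = v := fun v hv h1 =>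
      ((hu.2.2 v h1 hv.1).resolve_right hv.2.1).symm
    rcases hlam _ (e u).2 _ (e b).2 with h1 | h1 | h1
    · exact Or.inl (hle b hb' h1)
    · exact Or.inl ((hb'.2.2 u h1 hu.1).resolve_right hu.2.1)
    · exact Or.inr (hle c hc' (h1.subset_right_of_subset_union huz))
  rw [hcov, Set.ncard_pair]
  rintro rfl
  obtain ⟨x, hx⟩ := hne _ (e b).2
  exact Set.disjoint_left.1 hd hx hx

/-- An injection into a finite type extends to an enumeration of that type. -/
theorem exists_equiv_sum_fin {ι W : Type*} [Finite W] (f : ι → W) (hf : f.Injective) :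
    ∃ (k : ℕ) (e : ι ⊕ Fin k ≃ W), ∀ i, e (Sum.inl i) = f i := by
  classical
  refine ⟨Nat.card ↥(Set.range f)ᶜ, (Equiv.sumCongr (Equiv.ofInjective f hf)
    (Finite.equivFin ↥(Set.range f)ᶜ).symm).trans (Equiv.Set.sumCompl (Set.range f)), fun i => rfl⟩

end Realization

/-! ### Hierarchies of unrooted trees -/

namespace UnrootedBinaryTree

variable {L : Type}

/-- The order of the vertices of `T` in which `y` is above `x` if `y` lies between `x` and the
leaf `l`. -/
def le (T : UnrootedBinaryTree L) (l : L) (x y : L ⊕ Fin T.k) : Prop :=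
  IsOnPath T.graph x (Sum.inl l) y

/-- The clusters of `T`, seen from the leaf `l`. -/
def clusters (T : UnrootedBinaryTree L) (l : L) : Set (Set L) :=
  {A | l ∉ A ∧ A ∈ Set.range (cluster (T.le l) Sum.inl id)}

variable (T : UnrootedBinaryTree L) (l : L)

theorem isHasse : IsHasse T.graph (T.le l) (Sum.inl l) := isHasse_isOnPath T.isTree _

theorem mem_cluster_iff {x : L} {z : L ⊕ Fin T.k} :
    x ∈ cluster (T.le l) Sum.inl id z ↔ T.le l (Sum.inl x) z :=
  mem_cluster (g := id) Function.injective_id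

theorem ref_mem_cluster {z : L ⊕ Fin T.k} :
    l ∈ cluster (T.le l) Sum.inl id z ↔ z = Sum.inl l := by
  rw [mem_cluster_iff]
  refine ⟨fun h => (T.isHasse l).antisymm ((T.isHasse l).le_root z) h, ?_⟩
  rintro rfl
  exact (T.isHasse l).refl _

theorem ncard_covers_ref : {c | Covers (T.le l) c (Sum.inl l)}.ncard = 1 := by
  rw [← (T.isHasse l).ncard_neighborSet_root, T.degree_leaf]

theorem range_cluster :
    Set.range (cluster (T.le l) Sum.inl id) = insert Set.univ (T.clusters l) := by
  have h : cluster (T.le l) Sum.inl id (Sum.inl l) = Set.univ :=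
    ((T.isHasse l).cluster_root).trans Set.range_id
  ext A
  constructor
  · rintro ⟨z, rfl⟩
    by_cases hl : z = Sum.inl l
    · exact Or.inl (by rw [hl, h])
    · exact Or.inr ⟨by rwa [T.ref_mem_cluster l], z, rfl⟩
  · rintro (rfl | hA)
    · exact ⟨_, h⟩
    · exact hA.2

variable [Finite L]

theorem ncard_covers_inr (i : Fin T.k) : {c | Covers (T.le l) c (Sum.inr i)}.ncard = 2 := by
  have h := (T.isHasse l).ncard_neighborSet (x := Sum.inr i) Sum.inr_ne_inl
  rw [T.degree_inner] at h
  omega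

theorem ncard_covers_inl {x : L} (hx : x ≠ l) :
    {c | Covers (T.le l) c (Sum.inl x)}.ncard = 0 := by
  have h := (T.isHasse l).ncard_neighborSet (x := Sum.inl x) (Sum.inl_injective.ne hx)
  rw [T.degree_leaf] at h
  omega

theorem ncard_covers_of_notMem_range (z : L ⊕ Fin T.k) (hz : z ∉ Set.range Sum.inl) :
    {c | Covers (T.le l) c z}.ncard = 2 := by
  rcases z with x | i
  · exact absurd ⟨x, rfl⟩ hz
  · exact T.ncard_covers_inr l i

theorem isLeafTree : IsLeafTree T.graph (T.le l) (Sum.inl l) Sum.inl :=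
  (T.isHasse l).isLeafTree (T.ncard_covers_of_notMem_range l)

/-- The neighbour of the leaf `l` lies above all vertices except `l`. -/
theorem le_of_adj {v z : L ⊕ Fin T.k} (hv : T.graph.Adj (Sum.inl l) v) (hz : z ≠ Sum.inl l) :
    T.le l z v := by
  have h := T.isHasse l
  obtain ⟨c, hc⟩ := Set.ncard_eq_one.1 (T.ncard_covers_ref l)
  have hmem : ∀ u, Covers (T.le l) u (Sum.inl l) → u = c := fun u hu => by
    have : u ∈ {c | Covers (T.le l) c (Sum.inl l)} := hu
    simpa [hc] using this
  obtain ⟨u, hzu, hu⟩ := h.exists_le_covers (h.le_root z) hz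
  rcases (h.adj_iff _ _).1 hv with h1 | h1
  · exact absurd (h.antisymm h1.1 (h.le_root v)) h1.2.1
  · rwa [hmem v h1, ← hmem u hu]

theorem exists_adj : ∃ v, T.graph.Adj (Sum.inl l) v :=
  (Set.ncard_pos (Set.toFinite (T.graph.neighborSet (Sum.inl l)))).1
    ((T.degree_leaf l).symm ▸ Nat.one_pos)

theorem isHierarchy_clusters : IsHierarchy {l}ᶜ (T.clusters l) := by
  have h := T.isHasse l
  obtain ⟨v, hv⟩ := T.exists_adj l
  have hle : ∀ z, T.le l z v ↔ z ≠ Sum.inl l := by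
    refine fun z => ⟨fun hc hz => ?_, T.le_of_adj l hv⟩
    subst hz
    exact hv.ne (h.antisymm hc (h.le_root v))
  convert (T.isLeafTree l).isHierarchy (g := id) Sum.inl_injective Function.injective_id v
    (T.ncard_covers_of_notMem_range l) ?_ using 1
  · ext x
    rw [mem_cluster_iff, hle, Sum.inl_injective.ne_iff]
    rfl
  · ext A
    constructor
    · rintro ⟨hl, z, rfl⟩
      exact ⟨z, by rwa [hle, Ne, ← T.ref_mem_cluster l], rfl⟩
    · rintro ⟨z, hz, rfl⟩
      exact ⟨by rwa [T.ref_mem_cluster l, ← Ne, ← hle], z, rfl⟩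
  · exact fun x hx => T.ncard_covers_inl l fun he => (hle _).1 hx (by rw [he])

theorem cluster_inl (x : L) [Decidable (x = l)] :
    cluster (T.le l) Sum.inl id (Sum.inl x) = if x = l then Set.univ else {x} := by
  split_ifs with hx
  · rw [hx]
    exact ((T.isHasse l).cluster_root).trans Set.range_id
  · exact (T.isHasse l).cluster_leaf (g := id) Sum.inl_injective (T.ncard_covers_inl l hx)

theorem equiv_iff_clusters_eq {T T' : UnrootedBinaryTree L} (l : L) :
    T ≈ T' ↔ T.clusters l = T'.clusters l := by
  classical
  constructor
  · rintro ⟨e, he⟩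
    have h := range_cluster_iso (g := id) (f := Sum.inl) (f' := Sum.inl) e (he l) he
    unfold clusters
    exact congrArg (fun F => {A | l ∉ A ∧ A ∈ F}) h.symm
  · intro h
    obtain ⟨e, -, he⟩ := (T.isLeafTree l).exists_iso (T'.isLeafTree l) (g := id)
      Function.injective_id (by rw [range_cluster, range_cluster, h])
      (fun x => by rw [cluster_inl, cluster_inl])
    exact ⟨e, he⟩

/-- The vertices are the members of `K` together with `Set.univ`, which stands for `l`; the graph is
the Hasse diagram of inclusion. The only cover below `Set.univ` is the top member `{l}ᶜ`, so `l` has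
degree one. Singletons have only a parent, and all other members of `K` have a parent and two
children. -/
theorem exists_clusters_eq {l : L} {K : Set (Set L)} (hK : IsHierarchy {l}ᶜ K) :
    ∃ T : UnrootedBinaryTree L, T.clusters l = K := by
  classical
  have hlK : ∀ {A}, A ∈ K → l ∉ A := fun hA hl => hK.subset hA hl rfl
  have hne : ∀ A ∈ insert Set.univ K, A.Nonempty := by
    rintro A (rfl | hA)
    · exact ⟨l, trivial⟩
    · exact hK.nonempty hA
  have hlam : ∀ A ∈ insert Set.univ K, ∀ B ∈ insert Set.univ K,
      A ⊆ B ∨ B ⊆ A ∨ Disjoint A B := by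
    rintro A (rfl | hA) B (rfl | hB)
    · exact Or.inl subset_rfl
    · exact Or.inr (Or.inl (Set.subset_univ _))
    · exact Or.inl (Set.subset_univ _)
    · exact hK.laminar hA hB
  let f : L → ↥(insert Set.univ K) := fun x =>
    if hx : x = l then ⟨Set.univ, Or.inl rfl⟩ else ⟨{x}, Or.inr (hK.singleton_mem hx)⟩
  have hfl : (f l : Set L) = Set.univ := by simp [f]
  have hfx : ∀ x, x ≠ l → (f x : Set L) = {x} := fun x hx => by simp [f, hx]
  have huniv : ∀ x, x ≠ l → ({x} : Set L) ≠ Set.univ := fun x hx he =>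
    hx (he ▸ Set.mem_univ l : l ∈ ({x} : Set L)).symm
  have hf : f.Injective := by
    intro x y hxy
    replace hxy : (f x : Set L) = f y := congrArg Subtype.val hxy
    by_cases hx : x = l <;> by_cases hy : y = l
    · rw [hx, hy]
    · rw [hx, hfl, hfx y hy] at hxy
      exact absurd hxy.symm (huniv y hy)
    · rw [hy, hfl, hfx x hx] at hxy
      exact absurd hxy (huniv x hx)
    · rw [hfx x hx, hfx y hy] at hxy
      exact Set.singleton_injective hxy
  obtain ⟨k, e, he⟩ := exists_equiv_sum_fin f hf
  have hel : (e (Sum.inl l) : Set L) = Set.univ := by rw [he, hfl]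
  have hex : ∀ x, x ≠ l → (e (Sum.inl x) : Set L) = {x} := fun x hx => by rw [he, hfx x hx]
  have hH := isHasse_hasseGraph (fun A _ => Set.subset_univ A) hne hlam e hel
  have hin : ∀ {z}, z ≠ Sum.inl l → (e z : Set L) ∈ K := fun {z} hz =>
    (e z).2.resolve_left fun h => hz (e.injective (Subtype.ext (h.trans hel.symm)))
  have hle : ∀ x z, clusterLE e (Sum.inl x) z ↔ x ∈ (e z : Set L) := by
    intro x z
    unfold clusterLE
    by_cases hx : x = l
    · subst hx
      rw [hel, Set.univ_subset_iff]
      refine ⟨fun h => h.superset (Set.mem_univ x), fun h => (e z).2.resolve_right fun hc => hlK hc h⟩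
    · rw [hex x hx, Set.singleton_subset_iff]
  have hroot : {c | Covers (clusterLE e) c (Sum.inl l)}.ncard = 1 := by
    obtain ⟨v, hv⟩ := e.surjective ⟨{l}ᶜ, Or.inr hK.top_mem⟩
    have hv : (e v : Set L) = {l}ᶜ := by rw [hv]
    have hvl : v ≠ Sum.inl l := by
      rintro rfl
      rw [hel] at hv
      exact (hv ▸ Set.mem_univ l : l ∈ ({l}ᶜ : Set L)) rfl
    rw [Set.ncard_eq_one]
    refine ⟨v, ?_⟩
    have hcov : Covers (clusterLE e) v (Sum.inl l) := by
      refine ⟨hH.le_root v, hvl, fun z hz _ => ?_⟩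
      by_cases hzl : z = Sum.inl l
      · exact Or.inr hzl
      · refine Or.inl (hH.antisymm ?_ hz)
        unfold clusterLE
        rw [hv]
        exact hK.subset (hin hzl)
    ext c
    refine ⟨fun hc => ?_, by rintro rfl; exact hcov⟩
    have hcv : clusterLE e c v := by
      unfold clusterLE
      rw [hv]
      exact hK.subset (hin hc.2.1)
    exact ((hc.2.2 v hcv (hH.le_root v)).resolve_right hvl).symm
  refine ⟨⟨k, hasseGraph (clusterLE e), hH.isTree, fun x => ?_, fun i => ?_⟩, ?_⟩
  · by_cases hx : x = l
    · subst hx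
      rw [hH.ncard_neighborSet_root, hroot]
    · rw [hH.ncard_neighborSet (Sum.inl_injective.ne hx),
        ncard_covers_of_singleton hne e (hex x hx)]
  · rw [hH.ncard_neighborSet Sum.inr_ne_inl]
    -- An unlabelled vertex is not a singleton, because the singletons are already assigned to the
    -- leaves.
    rcases hK.split (hin (Sum.inr_ne_inl (b := i))) with ⟨x, hx⟩ | ⟨B, hB, C, hC, hd, hu⟩
    · have hxl : x ≠ l := by
        rintro rfl
        exact hlK (hin (Sum.inr_ne_inl (b := i))) (hx ▸ Set.mem_singleton x)
      exact absurd (e.injective (Subtype.ext (hx.trans (hex x hxl).symm))) Sum.inr_ne_inl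
    · rw [ncard_covers_of_union hne hlam e (Or.inr hB) (Or.inr hC) hd hu]
  · have hcl : ∀ z, cluster (fun x y => IsOnPath (hasseGraph (clusterLE e)) x (Sum.inl l) y)
        Sum.inl id z = e z := by
      intro z
      simp only [cluster, Set.image_id, hH.isOnPath_iff, hle]
      rfl
    ext A
    constructor
    · rintro ⟨hA, z, rfl⟩
      have h1 := hcl z
      unfold le at hA ⊢
      rw [h1] at hA ⊢
      exact (e z).2.resolve_left fun h => hA (h.superset (Set.mem_univ l))
    · intro hA
      obtain ⟨z, hz⟩ := e.surjective ⟨A, Or.inr hA⟩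
      refine ⟨hlK hA, z, (hcl z).trans ?_⟩
      rw [hz]

end UnrootedBinaryTree

/-! ### Hierarchies of rooted trees -/

namespace RootedBinaryTree

variable {L : Type} {S : Finset L}

/-- The order of the vertices of `R` in which the root is the greatest element. -/
def le {L : Type} (R : RootedBinaryTree L) (x y : L ⊕ Fin R.k) : Prop :=
  IsOnPath R.graph x R.root y

/-- The clusters of `R`. -/
def clusters (R : RootedBinaryTree S) : Set (Set L) :=
  Set.range (cluster R.le Sum.inl Subtype.val)

theorem isHasse {L : Type} (R : RootedBinaryTree L) : IsHasse R.graph R.le R.root :=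
  isHasse_isOnPath R.isTree _

variable (R : RootedBinaryTree S)

theorem ncard_covers_inl (x : S) : {c | Covers R.le c (Sum.inl x)}.ncard = 0 := by
  have h0 := R.degree_leaf x
  split_ifs at h0 with h
  · rw [h, ← R.isHasse.ncard_neighborSet_root, ← h, h0]
  · rw [R.isHasse.ncard_neighborSet h] at h0
    omega

theorem ncard_covers_of_notMem_range (z : S ⊕ Fin R.k) (hz : z ∉ Set.range Sum.inl) :
    {c | Covers R.le c z}.ncard = 2 := by
  rcases z with x | i
  · exact absurd ⟨x, rfl⟩ hz
  have h0 := R.degree_inner i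
  split_ifs at h0 with h
  · rw [h, ← R.isHasse.ncard_neighborSet_root, ← h, h0]
  · rw [R.isHasse.ncard_neighborSet h] at h0
    omega

theorem isLeafTree : IsLeafTree R.graph R.le R.root Sum.inl :=
  R.isHasse.isLeafTree R.ncard_covers_of_notMem_range

theorem cluster_inl (x : S) :
    cluster R.le Sum.inl Subtype.val (Sum.inl x) = {(x : L)} :=
  R.isHasse.cluster_leaf Sum.inl_injective (R.ncard_covers_inl x)

theorem isHierarchy_clusters : IsHierarchy (S : Set L) R.clusters := by
  convert R.isLeafTree.isHierarchy Sum.inl_injective Subtype.val_injective R.root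
    R.ncard_covers_of_notMem_range (fun x _ => R.ncard_covers_inl x) using 1
  · rw [R.isHasse.cluster_root]
    exact Subtype.range_val.symm
  · ext A
    exact exists_congr fun z => (and_iff_right (R.isHasse.le_root z)).symm

theorem equiv_iff_clusters_eq {R R' : RootedBinaryTree S} :
    R ≈ R' ↔ R.clusters = R'.clusters := by
  constructor
  · rintro ⟨e, hr, he⟩
    exact (range_cluster_iso e hr he).symm
  · intro h
    obtain ⟨e, hr, he⟩ := R.isLeafTree.exists_iso R'.isLeafTree Subtype.val_injective h
      (fun x => by rw [cluster_inl, cluster_inl])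
    exact ⟨e, hr, he⟩

/-- The Hasse diagram of `K` itself serves, rooted at the member `S`; no vertex is added for a
reference leaf. -/
theorem exists_clusters_eq [Finite L] {K : Set (Set L)} (hK : IsHierarchy (S : Set L) K) :
    ∃ R : RootedBinaryTree S, R.clusters = K := by
  have hne : ∀ A ∈ K, A.Nonempty := fun A hA => hK.nonempty hA
  have hlam : ∀ A ∈ K, ∀ B ∈ K, A ⊆ B ∨ B ⊆ A ∨ Disjoint A B := fun A hA B hB => hK.laminar hA hB
  let f : S → ↥K := fun x => ⟨{x.1}, hK.singleton_mem x.2⟩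
  have hf : f.Injective := fun x y hxy =>
    Subtype.ext (Set.singleton_injective (congrArg Subtype.val hxy))
  obtain ⟨k, e, he⟩ := exists_equiv_sum_fin f hf
  have hex : ∀ x, (e (Sum.inl x) : Set L) = {x.1} := fun x => by rw [he]
  obtain ⟨r, hr⟩ := e.surjective ⟨S, hK.top_mem⟩
  have hr : (e r : Set L) = S := by rw [hr]
  have hH := isHasse_hasseGraph (fun A hA => hK.subset hA) hne hlam e hr
  have h0 : ∀ x, {c | Covers (clusterLE e) c (Sum.inl x)}.ncard = 0 := fun x =>
    ncard_covers_of_singleton hne e (hex x)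
  have h2 : ∀ i, {c | Covers (clusterLE e) c (Sum.inr i)}.ncard = 2 := by
    intro i
    rcases hK.split (e (Sum.inr i)).2 with ⟨x, hx⟩ | ⟨B, hB, C, hC, hd, hu⟩
    · have hxS : x ∈ S := hK.subset (e (Sum.inr i)).2 (hx ▸ Set.mem_singleton x)
      exact absurd (e.injective (Subtype.ext (hx.trans (hex ⟨x, hxS⟩).symm))) Sum.inr_ne_inl
    · exact ncard_covers_of_union hne hlam e hB hC hd hu
  refine ⟨⟨k, hasseGraph (clusterLE e), r, hH.isTree, fun x => ?_, fun i => ?_⟩, ?_⟩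
  · split_ifs with h
    · rw [h, hH.ncard_neighborSet_root, ← h, h0]
    · rw [hH.ncard_neighborSet h, h0]
  · split_ifs with h
    · rw [h, hH.ncard_neighborSet_root, ← h, h2]
    · rw [hH.ncard_neighborSet h, h2]
  · have hcl : ∀ z, cluster (fun x y => IsOnPath (hasseGraph (clusterLE e)) x r y)
        Sum.inl Subtype.val z = e z := by
      intro z
      ext x
      simp only [cluster, hH.isOnPath_iff, clusterLE, hex, Set.singleton_subset_iff]
      constructor
      · rintro ⟨y, hy, rfl⟩
        exact hy
      · exact fun hx => ⟨⟨x, hK.subset (e z).2 hx⟩, hx, rfl⟩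
    ext A
    constructor
    · rintro ⟨z, rfl⟩
      have h1 := hcl z
      unfold le
      rw [h1]
      exact (e z).2
    · intro hA
      obtain ⟨z, hz⟩ := e.surjective ⟨A, hA⟩
      refine ⟨z, (hcl z).trans ?_⟩
      rw [hz]

end RootedBinaryTree

/-! ### The induced tree -/

/-- The vertex `z` lies above `A`, and no vertex below `z` lies above the same elements of `A`. -/
def IsBranchVertex {V : Type*} (le : V → V → Prop) (A : Set V) (z : V) : Prop :=
  (∃ a ∈ A, le a z) ∧ ∀ y, le y z → y ≠ z → ∃ a ∈ A, le a z ∧ ¬ le a y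

/-- The vertex `w` is the least one that lies above `A`. -/
def IsLeastAbove {V : Type*} (le : V → V → Prop) (A : Set V) (w : V) : Prop :=
  (∀ a ∈ A, le a w) ∧ ∀ u, (∀ a ∈ A, le a u) → le w u

/-! ### Kept vertices and the suppressed tree -/

section Induced

variable {V : Type*} {G : SimpleGraph V} {r w : V} {A : Set V}

local notation "ple" => fun x y => IsOnPath G x r y

theorem IsTreeOrder.exists_isLeastAbove [Finite V] {le : V → V → Prop} (h : IsTreeOrder le r)
    (hA : A.Nonempty) : ∃ w, IsLeastAbove le A w := by
  obtain ⟨a, ha⟩ := hA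
  obtain ⟨w, hw, -, hmin⟩ := h.exists_minimal (P := fun u => ∀ a ∈ A, le a u) (x := r)
    fun a _ => h.le_root a
  refine ⟨w, hw, fun u hu => ?_⟩
  rcases h.chain (hw a ha) (hu a ha) with h1 | h1
  · exact h1
  · rw [hmin u hu h1]
    exact h.refl w

theorem mem_pathVertices_iff (hG : G.IsTree) (hw : IsLeastAbove ple A w) {z : V} :
    z ∈ pathVertices G A w ↔ (∃ a ∈ A, IsOnPath G a r z) ∧ IsOnPath G z r w := by
  have : ∀ a ∈ A, (IsOnPath G w a z ↔ IsOnPath G a r z ∧ IsOnPath G z r w) := fun a ha => by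
    rw [← isOnPath_iff_of_isOnPath hG (hw.1 a ha)]
    exact ⟨IsOnPath.symm, IsOnPath.symm⟩
  constructor
  · rintro ⟨a, ha, hz⟩
    rw [this a ha] at hz
    exact ⟨⟨a, ha, hz.1⟩, hz.2⟩
  · rintro ⟨⟨a, ha, hz⟩, hzw⟩
    exact ⟨a, ha, (this a ha).2 ⟨hz, hzw⟩⟩

theorem ncard_neighborSet_pathTree [Finite V] (hG : G.IsTree) (hw : IsLeastAbove ple A w) {z : V}
    (hz : z ∈ pathVertices G A w) (hzw : z ≠ w) :
    ((pathTree G A w).neighborSet z).ncard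
      = {c | Covers ple c z ∧ ∃ a ∈ A, IsOnPath G a r c}.ncard + 1 := by
  have h := isHasse_isOnPath hG r
  have hz' := (mem_pathVertices_iff hG hw).1 hz
  obtain ⟨⟨a, ha, haz⟩, hzw'⟩ := hz'
  obtain ⟨p, hp, hpw⟩ := h.exists_covers_le hzw' hzw
  have : (pathTree G A w).neighborSet z
      = insert p {c | Covers ple c z ∧ ∃ a ∈ A, IsOnPath G a r c} := by
    ext c
    rw [SimpleGraph.mem_neighborSet, Set.mem_insert_iff]
    constructor
    · rintro ⟨hadj, -, hc⟩
      rcases (h.adj_iff _ _).1 hadj with h1 | h1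
      · exact Or.inl (h.covers_unique h1 hp)
      · exact Or.inr ⟨h1, ((mem_pathVertices_iff hG hw).1 hc).1⟩
    · rintro (rfl | ⟨hc, b, hb, hbc⟩)
      · exact ⟨(h.adj_iff _ _).2 (Or.inl hp), hz,
          (mem_pathVertices_iff hG hw).2 ⟨⟨a, ha, h.trans haz hp.1⟩, hpw⟩⟩
      · exact ⟨(h.adj_iff _ _).2 (Or.inr hc), hz,
          (mem_pathVertices_iff hG hw).2 ⟨⟨b, hb, hbc⟩, h.trans hc.1 hzw'⟩⟩
  rw [this, Set.ncard_insert_of_notMem]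
  exact fun hc => hc.1.2.1 (h.antisymm hc.1.1 hp.1)

/-- Below `w`, a vertex of the subtree has as neighbours its parent and those children that lie
above elements of `A`. Degree two therefore means exactly one such child, which is then above the
same elements of `A`. The hypothesis `hmin` makes the elements of `A` leaves. -/
theorem mem_keptVertices_iff [Finite V] (hG : G.IsTree) (hw : IsLeastAbove ple A w)
    (hmin : ∀ a ∈ A, ∀ c, ¬ Covers ple c a) {z : V} :
    z ∈ keptVertices G A w ↔ IsBranchVertex ple A z := by
  have h := isHasse_isOnPath hG r
  constructor
  · rintro ⟨hz, hk⟩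
    have hz' := (mem_pathVertices_iff hG hw).1 hz
    obtain ⟨⟨a, ha, haz⟩, -⟩ := hz'
    refine ⟨⟨a, ha, haz⟩, fun y hy hyz => ?_⟩
    by_contra! hc
    by_cases hzw : z = w
    · subst hzw
      exact hyz (h.antisymm hy (hw.2 y fun b hb => hc b hb (hw.1 b hb)))
    · rw [ncard_neighborSet_pathTree hG hw hz hzw] at hk
      -- Since `y` lies above all elements of `A` below `z`, the child of `z` leading to `y` is the
      -- only one above any of them; with the parent this makes degree two.
      refine hk.resolve_left hzw (congrArg (· + 1) (?_ : _ = 1))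
      obtain ⟨c, hyc, hcz⟩ := h.exists_le_covers hy hyz
      rw [Set.ncard_eq_one]
      refine ⟨c, ?_⟩
      ext u
      constructor
      · rintro ⟨hu, b, hb, hbu⟩
        by_contra hne
        rcases h.chain (h.trans (hc b hb (h.trans hbu hu.1)) hyc) hbu with h1 | h1
        · exact not_le_of_covers hcz hu (Ne.symm hne) h1
        · exact not_le_of_covers hu hcz hne h1
      · rintro rfl
        exact ⟨hcz, a, ha, h.trans (hc a ha haz) hyc⟩
  · rintro ⟨⟨a, ha, haz⟩, hb⟩
    have hzw : IsOnPath G z r w := by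
      rcases h.chain haz (hw.1 a ha) with h1 | h1
      · exact h1
      · by_cases he : w = z
        · rw [he]
          exact h.refl z
        · obtain ⟨b, hbA, -, hb'⟩ := hb w h1 he
          exact absurd (hw.1 b hbA) hb'
    have hz : z ∈ pathVertices G A w := (mem_pathVertices_iff hG hw).2 ⟨⟨a, ha, haz⟩, hzw⟩
    refine ⟨hz, or_iff_not_imp_left.2 fun hne hc => ?_⟩
    rw [ncard_neighborSet_pathTree hG hw hz hne, Nat.succ_inj, Set.ncard_eq_one] at hc
    obtain ⟨c, hc⟩ := hc
    have hmem : ∀ u, (Covers ple u z ∧ ∃ a ∈ A, IsOnPath G a r u) ↔ u = c := fun u =>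
      Set.ext_iff.1 hc u
    have hcz := ((hmem c).2 rfl).1
    obtain ⟨b, hbA, hbz, hbc⟩ := hb c hcz.1 hcz.2.1
    have hbz' : b ≠ z := by
      rintro rfl
      exact hmin b hbA c hcz
    obtain ⟨u, hbu, hu⟩ := h.exists_le_covers hbz hbz'
    have := (hmem u).1 ⟨hu, b, hbA, hbu⟩
    exact hbc (this ▸ hbu)

theorem IsLeastAbove.isBranchVertex [Finite V] (hG : G.IsTree) (hw : IsLeastAbove ple A w)
    (hA : A.Nonempty) : IsBranchVertex ple A w := by
  have h := isHasse_isOnPath hG r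
  obtain ⟨a, ha⟩ := hA
  refine ⟨⟨a, ha, hw.1 a ha⟩, fun y hy hyw => ?_⟩
  by_contra! hc
  exact hyw (h.antisymm hy (hw.2 y fun b hb => hc b hb (hw.1 b hb)))

theorem IsTreeOrder.isBranchVertex_of_mem {le : V → V → Prop} (h : IsTreeOrder le r) {a : V}
    (ha : a ∈ A) : IsBranchVertex le A a :=
  ⟨⟨a, ha, h.refl a⟩, fun _ hy hya => ⟨a, ha, h.refl a, fun hay => hya (h.antisymm hy hay)⟩⟩

/-- The least common ancestor of two branch vertices is a branch vertex. -/
theorem IsTreeOrder.isBranchVertex_of_lub {le : V → V → Prop} (h : IsTreeOrder le r) {x y m : V}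
    (hx : IsBranchVertex le A x) (hy : IsBranchVertex le A y) (hxm : le x m) (hym : le y m)
    (hm : ∀ u, le x u → le y u → le m u) : IsBranchVertex le A m := by
  refine ⟨hx.1.imp fun a ha => ⟨ha.1, h.trans ha.2 hxm⟩, fun u hu hum => ?_⟩
  by_contra! hc
  have key : ∀ x, IsBranchVertex le A x → le x m → le x u := by
    intro x hx hxm
    obtain ⟨⟨a, ha, hax⟩, hb⟩ := hx
    rcases h.chain hax (hc a ha (h.trans hax hxm)) with h1 | h1
    · exact h1
    · by_cases hux : u = x
      · rw [hux]
        exact h.refl x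
      · obtain ⟨b, hbA, hbx, hbu⟩ := hb u h1 hux
        exact absurd (hc b hbA (h.trans hbx hxm)) hbu
  exact hum (h.antisymm hu (hm u (key x hx hxm) (key y hy hym)))

theorem pathTree_le (G : SimpleGraph V) (A : Set V) (w : V) : pathTree G A w ≤ G :=
  fun _ _ h => h.1

/-- The path between kept vertices, one of which covers the other among kept vertices, has no kept
vertex in its interior. Conversely, a path with no kept interior vertex passes through the least
common ancestor of its ends. That ancestor is a branch vertex, hence kept, hence one of the ends, so
the ends are comparable with no kept vertex strictly between them. -/
theorem isHasse_suppressedTree [Finite V] (hG : G.IsTree) (hw : IsLeastAbove ple A w)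
    (hmin : ∀ a ∈ A, ∀ c, ¬ Covers ple c a) (hwk : w ∈ keptVertices G A w) :
    IsHasse (suppressedTree G A w) (fun x y => IsOnPath G (x : V) r y) ⟨w, hwk⟩ := by
  have h := isHasse_isOnPath hG r
  have hk : ∀ {z}, z ∈ keptVertices G A w ↔ IsBranchVertex ple A z :=
    mem_keptVertices_iff hG hw hmin
  have hpv : ∀ {z}, z ∈ pathVertices G A w ↔ _ := mem_pathVertices_iff hG hw
  have up : ∀ x y : keptVertices G A w,
      Covers (fun x y : keptVertices G A w => IsOnPath G (x : V) r y) x y →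
      JoinedOutside (pathTree G A w) (keptVertices G A w) x y := by
    rintro x y ⟨hxy, hne, hc⟩
    obtain ⟨p, hp, -⟩ := hG.existsUnique_path (x : V) y
    have hsup : ∀ z, z ∈ p.support ↔ IsOnPath G x r z ∧ IsOnPath G z r y := fun z => by
      rw [← isOnPath_iff_mem_support hG hp, isOnPath_iff_of_isOnPath hG hxy]
    have hV : ∀ z ∈ p.support, z ∈ pathVertices G A w := by
      intro z hz
      obtain ⟨h1, h2⟩ := (hsup z).1 hz
      obtain ⟨a, ha, hax⟩ := (hpv.1 x.2.1).1
      exact hpv.2 ⟨⟨a, ha, h.trans hax h1⟩, h.trans h2 (hpv.1 y.2.1).2⟩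
    have hE : ∀ e ∈ p.edges, e ∈ (pathTree G A w).edgeSet := by
      intro e he
      induction e with
      | _ u v =>
        exact ⟨p.adj_of_mem_edges he, hV u (p.fst_mem_support_of_mem_edges he),
          hV v (p.snd_mem_support_of_mem_edges he)⟩
    refine ⟨p.transfer _ hE, hp.transfer hE, fun z hz hzk => ?_⟩
    rw [SimpleGraph.Walk.support_transfer] at hz
    obtain ⟨h1, h2⟩ := (hsup z).1 hz
    exact (hc ⟨z, hzk⟩ h1 h2).imp (congrArg Subtype.val) (congrArg Subtype.val)
  refine ⟨⟨fun x => h.refl x.1, fun h1 h2 => h.trans h1 h2,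
    fun h1 h2 => Subtype.ext (h.antisymm h1 h2), fun x => (hpv.1 x.2.1).2,
    fun h1 h2 => h.chain h1 h2⟩, fun x y => ?_⟩
  constructor
  · rintro ⟨hne, p, hp, hpk⟩
    have hne' : (x : V) ≠ y := fun he => hne (Subtype.ext he)
    have hp' := (SimpleGraph.Walk.isPath_mapLe (pathTree_le G A w)).2 hp
    have hs : (p.mapLe (pathTree_le G A w)).support = p.support := by simp
    obtain ⟨m, hm, hxm, hym, hlub⟩ := h.exists_lub_mem_support (p.mapLe (pathTree_le G A w))
    rw [hs] at hm
    have hmk := hk.2 (h.isBranchVertex_of_lub (hk.1 x.2) (hk.1 y.2) hxm hym hlub)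
    rcases hpk m hm hmk with rfl | rfl
    · right
      refine ⟨hym, hne.symm, fun z h1 h2 => ?_⟩
      refine ((hpk z ?_ z.2).symm).imp Subtype.ext Subtype.ext
      rw [← hs, ← isOnPath_iff_mem_support hG hp']
      exact ((isOnPath_iff_of_isOnPath hG hym).2 ⟨h1, h2⟩).symm
    · left
      refine ⟨hxm, hne, fun z h1 h2 => ?_⟩
      refine (hpk z ?_ z.2).imp Subtype.ext Subtype.ext
      rw [← hs, ← isOnPath_iff_mem_support hG hp']
      exact (isOnPath_iff_of_isOnPath hG hxm).2 ⟨h1, h2⟩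
  · rintro (hc | hc)
    · exact ⟨hc.2.1, up x y hc⟩
    · exact ⟨hc.2.1.symm, (up y x hc).symm⟩

end Induced

/-! ### Inducing as restriction of hierarchies -/

section Induces

variable {L : Type} [Finite L]

/-- All paths from `S` to `l` enter `l` through `v`, so the paths towards `v` are the paths towards
`l` without their last vertex. A common ancestor not below `v` is above `v` and so imposes nothing
new. -/
theorem UnrootedBinaryTree.isFirstCommonVertex_iff (T : UnrootedBinaryTree L) {l : L}
    {S : Finset L} (hl : l ∉ S) (hS : S.Nonempty) {v w : L ⊕ Fin T.k}
    (hv : T.graph.Adj (Sum.inl l) v) :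
    IsFirstCommonVertex T.graph (Sum.inl '' (S : Set L)) v w ↔
      IsLeastAbove (T.le l) (Sum.inl '' (S : Set L)) w := by
  have h := T.isHasse l
  have hlow : ∀ a ∈ (Sum.inl '' (S : Set L) : Set (L ⊕ Fin T.k)), T.le l a v := by
    rintro _ ⟨x, hx, rfl⟩
    refine T.le_of_adj l hv (Sum.inl_injective.ne ?_)
    rintro rfl
    exact hl hx
  have hpath : ∀ {x u : L ⊕ Fin T.k}, T.le l x v →
      (IsOnPath T.graph x v u ↔ T.le l x u ∧ T.le l u v) :=
    fun hx => isOnPath_iff_of_isOnPath T.isTree hx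
  obtain ⟨s, hs⟩ := hS
  have hsA : (Sum.inl s : L ⊕ Fin T.k) ∈ (Sum.inl '' (S : Set L) : Set (L ⊕ Fin T.k)) :=
    ⟨s, hs, rfl⟩
  constructor
  · rintro ⟨h1, h2⟩
    have hwv : T.le l w v := ((hpath (hlow _ hsA)).1 (h1 _ hsA)).2
    refine ⟨fun a ha => ((hpath (hlow a ha)).1 (h1 a ha)).1, fun u hu => ?_⟩
    rcases h.chain (hu _ hsA) (hlow _ hsA) with h3 | h3
    · exact ((hpath hwv).1 (h2 u fun a ha => (hpath (hlow a ha)).2 ⟨hu a ha, h3⟩)).1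
    · exact h.trans hwv h3
  · rintro ⟨h1, h2⟩
    have hwv : T.le l w v := h2 v hlow
    refine ⟨fun a ha => (hpath (hlow a ha)).2 ⟨h1 a ha, hwv⟩, fun u hu => ?_⟩
    rw [hpath hwv]
    exact ⟨h2 u fun a ha => ((hpath (hlow a ha)).1 (hu a ha)).1,
      ((hpath (hlow _ hsA)).1 (hu _ hsA)).2⟩

/-- Among the vertices below a given one with the same nonempty trace on `S`, a minimal one is a
branch vertex. Restricting to branch vertices therefore loses no trace. -/
theorem UnrootedBinaryTree.range_cluster_suppressedTree (T : UnrootedBinaryTree L) {l : L}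
    {S : Finset L} (hl : l ∉ S) {K : Set (L ⊕ Fin T.k)} {f : S → K}
    (hf : ∀ s, (f s : L ⊕ Fin T.k) = Sum.inl s.1)
    (hK : ∀ z, z ∈ K ↔ IsBranchVertex (T.le l) (Sum.inl '' (S : Set L)) z) :
    Set.range (cluster (fun x y : K => T.le l x y) f Subtype.val)
      = restrictFamily S (T.clusters l) := by
  have h := T.isHasse l
  have hcl : ∀ z : K, cluster (fun x y : K => T.le l x y) f Subtype.val z
      = cluster (T.le l) Sum.inl id z ∩ S := by
    intro z
    ext x
    rw [Set.mem_inter_iff, T.mem_cluster_iff]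
    constructor
    · rintro ⟨s, hs, rfl⟩
      rw [Set.mem_ofPred_eq, hf] at hs
      exact ⟨hs, s.2⟩
    · rintro ⟨h1, h2⟩
      refine ⟨⟨x, h2⟩, ?_, rfl⟩
      change T.le l (f ⟨x, h2⟩ : L ⊕ Fin T.k) z
      rw [hf]
      exact h1
  have hrestrict : ∀ D, D ∈ restrictFamily (S : Set L) (T.clusters l) ↔
      D.Nonempty ∧ ∃ z, cluster (T.le l) Sum.inl id z ∩ S = D := by
    refine fun D => and_congr_right fun _ => ⟨?_, ?_⟩
    · rintro ⟨_, ⟨-, z, rfl⟩, hD⟩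
      exact ⟨z, hD⟩
    · rintro ⟨z, rfl⟩
      have hz : cluster (T.le l) Sum.inl id z ∈ insert Set.univ (T.clusters l) :=
        T.range_cluster l ▸ ⟨z, rfl⟩
      -- The cluster `Set.univ` of `l` is not in `T.clusters l`, but its trace is that of the top
      -- member `{l}ᶜ`, because `l ∉ S`.
      rcases hz with hz | hz
      · refine ⟨{l}ᶜ, (T.isHierarchy_clusters l).top_mem, ?_⟩
        rw [hz, Set.univ_inter, Set.inter_eq_right]
        rintro x hx rfl
        exact hl hx
      · exact ⟨_, hz, rfl⟩
  ext D
  rw [hrestrict]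
  constructor
  · rintro ⟨z, rfl⟩
    rw [hcl]
    refine ⟨?_, z, rfl⟩
    obtain ⟨⟨_, ⟨s, hs, rfl⟩, hsz⟩, -⟩ := (hK z).1 z.2
    exact ⟨s, (T.mem_cluster_iff l).2 hsz, hs⟩
  · rintro ⟨⟨s, hsD⟩, z, rfl⟩
    obtain ⟨hs, hsS⟩ := hsD
    obtain ⟨y, hy, -, hmin⟩ := h.exists_minimal
      (P := fun y => cluster (T.le l) Sum.inl id y ∩ S = cluster (T.le l) Sum.inl id z ∩ S)
      (x := z) rfl
    have hmem : ∀ x ∈ S, T.le l (Sum.inl x) y ↔ T.le l (Sum.inl x) z := by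
      intro x hx
      have := Set.ext_iff.1 hy x
      simpa [T.mem_cluster_iff, hx] using this
    have hyK : y ∈ K := by
      rw [hK]
      refine ⟨⟨_, ⟨s, hsS, rfl⟩, (hmem s hsS).2 ((T.mem_cluster_iff l).1 hs)⟩, fun u hu huy => ?_⟩
      by_contra! hc
      refine huy (hmin u ?_ hu)
      rw [← hy]
      ext x
      simp only [Set.mem_inter_iff, T.mem_cluster_iff]
      exact and_congr_left fun hx => ⟨fun h1 => h.trans h1 hu, fun h1 => hc _ ⟨x, hx, rfl⟩ h1⟩
    exact ⟨⟨y, hyK⟩, (hcl _).trans hy⟩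

/-- The set `S` induces `R` in `T` if and only if the clusters of `R` are the nonempty traces on `S`
of the clusters of `T`. -/
theorem UnrootedBinaryTree.induces_iff (T : UnrootedBinaryTree L) {l : L} {S : Finset L}
    (hl : l ∉ S) (hS : S.Nonempty) (R : RootedBinaryTree S) :
    T.Induces l S R ↔ restrictFamily S (T.clusters l) = R.clusters := by
  have h := T.isHasse l
  obtain ⟨v, hv⟩ := T.exists_adj l
  have hA : (Sum.inl '' (S : Set L) : Set (L ⊕ Fin T.k)).Nonempty := Set.Nonempty.image _ hS
  have hmin : ∀ a ∈ (Sum.inl '' (S : Set L) : Set (L ⊕ Fin T.k)), ∀ c,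
      ¬ Covers (T.le l) c a := by
    rintro _ ⟨x, hx, rfl⟩ c hc
    have h1 := T.ncard_covers_inl l (x := x) (by rintro rfl; exact hl hx)
    rw [Set.ncard_eq_zero (Set.toFinite _)] at h1
    exact Set.notMem_empty c (h1 ▸ hc)
  have key : ∀ {w}, IsLeastAbove (T.le l) (Sum.inl '' (S : Set L)) w →
      ((∃ e : suppressedTree T.graph (Sum.inl '' (S : Set L)) w ≃g R.graph,
        (e.symm R.root : L ⊕ Fin T.k) = w ∧
          ∀ s : S, (e.symm (Sum.inl s) : L ⊕ Fin T.k) = Sum.inl (s : L)) ↔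
        restrictFamily S (T.clusters l) = R.clusters) := by
    intro w hw
    have hk : ∀ z, z ∈ keptVertices T.graph (Sum.inl '' (S : Set L)) w ↔ _ := fun z =>
      mem_keptVertices_iff T.isTree hw hmin
    have hwk := (hk w).2 (hw.isBranchVertex T.isTree hA)
    have hH := isHasse_suppressedTree T.isTree hw hmin hwk
    let f : S → keptVertices T.graph (Sum.inl '' (S : Set L)) w := fun s =>
      ⟨Sum.inl s, (hk _).2 (h.isBranchVertex_of_mem ⟨s, s.2, rfl⟩)⟩
    have hrange := T.range_cluster_suppressedTree hl (f := f) (fun _ => rfl) hk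
    constructor
    · rintro ⟨e, hr, hf⟩
      have he : e ⟨w, hwk⟩ = R.root := by
        rw [← e.apply_symm_apply R.root]
        exact congrArg e (Subtype.ext hr.symm)
      have hef : ∀ s, e (f s) = Sum.inl s := fun s => by
        rw [← e.apply_symm_apply (Sum.inl s)]
        exact congrArg e (Subtype.ext (hf s).symm)
      have h1 := range_cluster_iso (g := (Subtype.val : S → L)) e he hef
      simp only [hH.isOnPath_iff] at h1
      exact hrange.symm.trans h1.symm
    · intro hR
      -- The two clauses of `IsBranchVertex` supply the two leaf conditions, so no degrees in the
      -- suppressed tree have to be computed.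
      have hlt : IsLeafTree (suppressedTree T.graph (Sum.inl '' (S : Set L)) w)
          (fun x y => T.le l x y) ⟨w, hwk⟩ f :=
        { hH with
          exists_leaf := fun z => by
            obtain ⟨⟨_, ⟨s, hs, rfl⟩, hsz⟩, -⟩ := (hk z).1 z.2
            exact ⟨⟨s, hs⟩, hsz⟩
          exists_leaf_of_covers := fun {x y} hxy => by
            obtain ⟨_, ⟨s, hs, rfl⟩, hsy, hsx⟩ := ((hk y).1 y.2).2 x hxy.1
              fun he => hxy.2.1 (Subtype.ext he)
            exact ⟨⟨s, hs⟩, hsy, hsx⟩ }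
      obtain ⟨e, he, hef⟩ := hlt.exists_iso R.isLeafTree Subtype.val_injective (hrange.trans hR)
        fun s => by
          rw [R.cluster_inl, cluster, ← Set.image_singleton]
          congr 1
          ext s'
          refine ⟨fun hs => ?_, by rintro rfl; exact hlt.refl _⟩
          by_contra hne
          obtain ⟨c, -, hc⟩ := h.exists_le_covers hs
            fun he => hne (Subtype.ext (Sum.inl_injective he))
          exact hmin _ ⟨s, s.2, rfl⟩ c hc
      refine ⟨e, ?_, fun s => ?_⟩
      · rw [← he, RelIso.symm_apply_apply]
      · rw [← hef, RelIso.symm_apply_apply]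
  constructor
  · rintro ⟨v, w, hv, hw, he⟩
    exact (key ((T.isFirstCommonVertex_iff hl hS hv).1 hw)).1 he
  · intro hR
    obtain ⟨w, hw⟩ := h.exists_isLeastAbove hA
    exact ⟨v, w, hv, (T.isFirstCommonVertex_iff hl hS hv).2 hw, (key hw).2 hR⟩

end Induces

/-! ### Counting -/

section Counting

variable {L : Type} [Finite L]

/-- Unrooted trees correspond to hierarchies on the leaves other than the reference leaf. -/
theorem exists_equiv_unrooted (l : L) :
    ∃ e : UnrootedLabelledTree L ≃ {K // IsHierarchy ({l}ᶜ : Set L) K},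
      ∀ T : UnrootedBinaryTree L, (e ⟦T⟧ : Set (Set L)) = T.clusters l := by
  refine ⟨Equiv.ofBijective (Quotient.lift (fun T => ⟨T.clusters l, T.isHierarchy_clusters l⟩)
    fun T T' h => Subtype.ext ((UnrootedBinaryTree.equiv_iff_clusters_eq l).1 h)) ⟨?_, ?_⟩,
    fun T => rfl⟩
  · rintro ⟨T⟩ ⟨T'⟩ h
    exact Quotient.sound
      ((UnrootedBinaryTree.equiv_iff_clusters_eq l).2 (congrArg Subtype.val h))
  · rintro ⟨K, hK⟩
    obtain ⟨T, rfl⟩ := UnrootedBinaryTree.exists_clusters_eq hK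
    exact ⟨⟦T⟧, rfl⟩

/-- Rooted trees correspond to hierarchies on the leaf-set. -/
theorem exists_equiv_rooted (S : Finset L) :
    ∃ e : RootedLabelledTree S ≃ {K // IsHierarchy (S : Set L) K},
      ∀ R : RootedBinaryTree S, (e ⟦R⟧ : Set (Set L)) = R.clusters := by
  refine ⟨Equiv.ofBijective (Quotient.lift (fun R => ⟨R.clusters, R.isHierarchy_clusters⟩)
    fun R R' h => Subtype.ext (RootedBinaryTree.equiv_iff_clusters_eq.1 h)) ⟨?_, ?_⟩,
    fun R => rfl⟩
  · rintro ⟨R⟩ ⟨R'⟩ h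
    exact Quotient.sound (RootedBinaryTree.equiv_iff_clusters_eq.2 (congrArg Subtype.val h))
  · rintro ⟨K, hK⟩
    obtain ⟨R, rfl⟩ := RootedBinaryTree.exists_clusters_eq hK
    exact ⟨⟦R⟧, rfl⟩

instance [Nonempty L] : Finite (UnrootedLabelledTree L) := by
  obtain ⟨e, -⟩ := exists_equiv_unrooted (Classical.arbitrary L)
  exact Finite.of_equiv _ e.symm

instance (S : Finset L) : Finite (RootedLabelledTree S) := by
  obtain ⟨e, -⟩ := exists_equiv_rooted S
  exact Finite.of_equiv _ e.symm

theorem ncard_compl_singleton (l : L) : ({l}ᶜ : Set L).ncard = Nat.card L - 1 := by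
  have h := Set.ncard_add_ncard_compl ({l} : Set L)
  rw [Set.ncard_singleton] at h
  omega

theorem card_unrootedLabelledTree (h : 2 ≤ Nat.card L) :
    Nat.card (UnrootedLabelledTree L) = (2 * Nat.card L - 5)‼ := by
  have : Nontrivial L := Finite.one_lt_card_iff_nontrivial.1 h
  obtain ⟨l, l', hl⟩ := exists_pair_ne L
  obtain ⟨e, -⟩ := exists_equiv_unrooted l
  rw [Nat.card_congr e, IsHierarchy.card_isHierarchy ⟨l', hl.symm⟩, ncard_compl_singleton]
  congr 1
  omega

theorem card_rootedLabelledTree {S : Finset L} (hS : S.Nonempty) :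
    Nat.card (RootedLabelledTree S) = (2 * S.card - 3)‼ := by
  obtain ⟨e, -⟩ := exists_equiv_rooted S
  rw [Nat.card_congr e, IsHierarchy.card_isHierarchy (by exact_mod_cast hS), Set.ncard_coe_finset]

theorem card_induces_mul {S : Finset L} (hS : S.Nonempty) {l : L} (hl : l ∉ S)
    (R : RootedLabelledTree S) :
    Nat.card {T : UnrootedLabelledTree L // T.Induces l S R} * (2 * S.card - 3)‼
      = (2 * Nat.card L - 5)‼ := by
  induction R using Quotient.inductionOn with | _ R
  obtain ⟨e, he⟩ := exists_equiv_unrooted l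
  have hSl : (S : Set L) ⊆ {l}ᶜ := by
    rintro x hx rfl
    exact hl hx
  have e' : {T : UnrootedLabelledTree L // T.Induces l S ⟦R⟧} ≃
      {K : {K // IsHierarchy ({l}ᶜ : Set L) K} // restrictFamily S K.1 = R.clusters} := by
    refine e.subtypeEquiv fun T => ?_
    induction T using Quotient.inductionOn with | _ T
    rw [he]
    exact T.induces_iff hl hS R
  rw [Nat.card_congr (e'.trans (Equiv.subtypeSubtypeEquivSubtypeInter _
      fun K => restrictFamily (S : Set L) K = R.clusters)),
    ← Set.ncard_coe_finset S, R.isHierarchy_clusters.card_restrict_mul hSl, ncard_compl_singleton]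
  congr 1
  omega

theorem UnrootedLabelledTree.Induces.unique {T : UnrootedLabelledTree L} {S : Finset L}
    (hS : S.Nonempty) {l : L} (hl : l ∉ S) {R R' : RootedLabelledTree S} (h : T.Induces l S R)
    (h' : T.Induces l S R') : R = R' := by
  induction T using Quotient.inductionOn with | _ T
  induction R using Quotient.inductionOn with | _ R
  induction R' using Quotient.inductionOn with | _ R'
  have h1 := (T.induces_iff hl hS R).1 h
  have h2 := (T.induces_iff hl hS R').1 h'
  exact Quotient.sound (RootedBinaryTree.equiv_iff_clusters_eq.2 (h1.symm.trans h2))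

end Counting

/-! ### The expected number of agreements -/

section Probability

open MeasureTheory ProbabilityTheory

open Classical in
-- Each `S` induces at most one tree in `T`, so at most one `R` contributes. The existential becomes
-- a sum of indicators to which linearity and independence apply.
theorem agreementCount_eq_sum {n a : ℕ} (ha : 0 < a) {ref : Finset (Fin n) → Fin n}
    (href : ∀ S : Finset (Fin n), S.card = a → ref S ∉ S)
    [∀ S : Finset (Fin n), Fintype (RootedLabelledTree S)]
    (T T' : UnrootedLabelledTree (Fin n)) :
    agreementCount ref a T T' = ∑ S ∈ Finset.powersetCard a Finset.univ,
      ∑ R : RootedLabelledTree S, if T.Induces (ref S) S R ∧ T'.Induces (ref S) S R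
        then 1 else 0 := by
  have h1 : {S : Finset (Fin n) | S.card = a ∧
      ∃ R : RootedLabelledTree S, T.Induces (ref S) S R ∧ T'.Induces (ref S) S R}
      = ((Finset.powersetCard a (Finset.univ : Finset (Fin n))).filter fun S =>
        ∃ R : RootedLabelledTree S, T.Induces (ref S) S R ∧ T'.Induces (ref S) S R :
          Finset (Finset (Fin n))) := by
    ext S
    simp [Finset.mem_powersetCard]
  rw [agreementCount, h1, Set.ncard_coe_finset, Finset.card_filter]
  refine Finset.sum_congr rfl fun S hS => ?_
  have hSa := (Finset.mem_powersetCard.1 hS).2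
  have hSn : S.Nonempty := Finset.card_pos.1 (hSa ▸ ha)
  split_ifs with h
  · obtain ⟨R, hR⟩ := h
    rw [Finset.sum_eq_single R, if_pos hR]
    · exact fun R' _ hne => if_neg fun hR' => hne (hR'.1.unique hSn (href S hSa) hR.1)
    · exact fun hc => absurd (Finset.mem_univ R) hc
  · exact (Finset.sum_eq_zero fun R _ => if_neg fun hR => h ⟨R, hR⟩).symm

theorem uniformOn_univ_real {α : Type*} [Finite α] [MeasurableSpace α]
    [MeasurableSingletonClass α] (E : Set α) :
    (uniformOn (Set.univ : Set α)).real E = (Nat.card E : ℝ) / Nat.card α := by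
  have := Fintype.ofFinite α
  rw [Measure.real, uniformOn_univ, Measure.count_apply_finite E (Set.toFinite E),
    ENNReal.toReal_div, ENNReal.toReal_natCast, ENNReal.toReal_natCast,
    ← Set.ncard_eq_toFinset_card E (Set.toFinite E), Nat.card_coe_set_eq,
    Nat.card_eq_fintype_card (α := α)]

end Probability

/-! ### The count and the expectation -/

theorem lemma1 (n a : ℕ) (ha : 1 < a) (han : a < n) :
    (∀ S : Finset (Fin n), S.card = a → ∀ l : Fin n, l ∉ S → ∀ R : RootedLabelledTree S,
      (Nat.card {T : UnrootedLabelledTree (Fin n) // T.Induces l S R} : ℝ)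
        = ((2 * n - 5)‼ : ℝ) / ((2 * a - 3)‼ : ℝ)) ∧
    (∀ ref : Finset (Fin n) → Fin n, (∀ S : Finset (Fin n), S.card = a → ref S ∉ S) →
      ∀ (Ω : Type*) [MeasurableSpace Ω] (P : MeasureTheory.Measure Ω)
        [MeasureTheory.IsProbabilityMeasure P] (T' T'' : Ω → UnrootedLabelledTree (Fin n)),
        Measurable T' → Measurable T'' →
        P.map T' = ProbabilityTheory.uniformOn Set.univ →
        P.map T'' = ProbabilityTheory.uniformOn Set.univ →
        ProbabilityTheory.IndepFun T' T'' P →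
        ∫ ω, (agreementCount ref a (T' ω) (T'' ω) : ℝ) ∂P
          = (n.choose a : ℝ) / ((2 * a - 3)‼ : ℝ)) := by
  classical
  have hM : ((2 * a - 3)‼ : ℝ) ≠ 0 := Nat.cast_ne_zero.2 (Nat.doubleFactorial_pos _).ne'
  have hN : ((2 * n - 5)‼ : ℝ) ≠ 0 := Nat.cast_ne_zero.2 (Nat.doubleFactorial_pos _).ne'
  have hi : ∀ S : Finset (Fin n), S.card = a → ∀ l : Fin n, l ∉ S → ∀ R : RootedLabelledTree S,
      (Nat.card {T : UnrootedLabelledTree (Fin n) // T.Induces l S R} : ℝ)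
        = ((2 * n - 5)‼ : ℝ) / ((2 * a - 3)‼ : ℝ) := by
    intro S hS l hl R
    have h := card_induces_mul (Finset.card_pos.1 (by omega)) hl R
    rw [hS, Nat.card_fin] at h
    rw [eq_div_iff hM]
    exact_mod_cast h
  refine ⟨hi, ?_⟩
  intro ref href Ω _ P _ T' T'' hT' hT'' hu' hu'' hind
  have : Nonempty (Fin n) := ⟨⟨0, by omega⟩⟩
  have : ∀ S : Finset (Fin n), Fintype (RootedLabelledTree S) := fun S => Fintype.ofFinite _
  have : MeasurableSingletonClass (UnrootedLabelledTree (Fin n)) := ⟨fun _ => trivial⟩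
  let E (S : Finset (Fin n)) (R : RootedLabelledTree S) : Set (UnrootedLabelledTree (Fin n)) :=
    {T | T.Induces (ref S) S R}
  have hE : ∀ S R, MeasurableSet (E S R) := fun _ _ => trivial
  -- The count in (i) is divided by the total number `(2n-5)‼` of unrooted trees, which cancels.
  have hprob : ∀ S : Finset (Fin n), S.card = a → ∀ R : RootedLabelledTree S,
      (ProbabilityTheory.uniformOn Set.univ).real (E S R) = 1 / ((2 * a - 3)‼ : ℝ) := by
    intro S hS R
    have h1 : (Nat.card (E S R) : ℝ) = ((2 * n - 5)‼ : ℝ) / ((2 * a - 3)‼ : ℝ) :=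
      hi S hS (ref S) (href S hS) R
    rw [uniformOn_univ_real, h1, card_unrootedLabelledTree (by rw [Nat.card_fin]; omega),
      Nat.card_fin]
    field_simp
  have hinter : ∀ S : Finset (Fin n), S.card = a → ∀ R : RootedLabelledTree S,
      P.real (T' ⁻¹' E S R ∩ T'' ⁻¹' E S R) = 1 / ((2 * a - 3)‼ : ℝ) * (1 / ((2 * a - 3)‼ : ℝ)) := by
    intro S hS R
    have h1 := hprob S hS R
    have h2 := h1
    rw [← hu', MeasureTheory.map_measureReal_apply hT' (hE S R)] at h1
    rw [← hu'', MeasureTheory.map_measureReal_apply hT'' (hE S R)] at h2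
    rw [MeasureTheory.Measure.real, hind.measure_inter_preimage_eq_mul _ _ (hE S R) (hE S R),
      ENNReal.toReal_mul]
    exact congrArg₂ (· * ·) h1 h2
  have hmeas : ∀ S R, MeasurableSet (T' ⁻¹' E S R ∩ T'' ⁻¹' E S R) := fun S R =>
    (hT' (hE S R)).inter (hT'' (hE S R))
  have hint : ∀ S R, MeasureTheory.Integrable
      (Set.indicator (T' ⁻¹' E S R ∩ T'' ⁻¹' E S R) (1 : Ω → ℝ)) P := fun S R =>
    (MeasureTheory.integrable_const (1 : ℝ)).indicator (hmeas S R)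
  have hcount : ∀ ω, (agreementCount ref a (T' ω) (T'' ω) : ℝ)
      = ∑ S ∈ Finset.powersetCard a Finset.univ, ∑ R : RootedLabelledTree S,
        Set.indicator (T' ⁻¹' E S R ∩ T'' ⁻¹' E S R) (1 : Ω → ℝ) ω := by
    intro ω
    rw [agreementCount_eq_sum (by omega) href]
    push_cast
    refine Finset.sum_congr rfl fun S _ => Finset.sum_congr rfl fun R _ => ?_
    rw [Set.indicator_apply]
    rfl
  simp only [hcount]
  rw [MeasureTheory.integral_finsetSum _ fun S _ =>
    MeasureTheory.integrable_finsetSum _ fun R _ => hint S R]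
  -- There are `(2a-3)‼` trees `R` on `S`, and by independence each contributes the square of `1 /
  -- (2a-3)‼`.
  have hS : ∀ S ∈ Finset.powersetCard a (Finset.univ : Finset (Fin n)),
      ∫ ω, ∑ R : RootedLabelledTree S,
        Set.indicator (T' ⁻¹' E S R ∩ T'' ⁻¹' E S R) (1 : Ω → ℝ) ω ∂P
          = 1 / ((2 * a - 3)‼ : ℝ) := by
    intro S hS
    have hSa := (Finset.mem_powersetCard.1 hS).2
    rw [MeasureTheory.integral_finsetSum _ fun R _ => hint S R]
    have h1 : ∀ R ∈ (Finset.univ : Finset (RootedLabelledTree S)),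
        ∫ ω, Set.indicator (T' ⁻¹' E S R ∩ T'' ⁻¹' E S R) (1 : Ω → ℝ) ω ∂P
          = 1 / ((2 * a - 3)‼ : ℝ) * (1 / ((2 * a - 3)‼ : ℝ)) := fun R _ => by
      rw [MeasureTheory.integral_indicator_one (hmeas S R), hinter S hSa R]
    rw [Finset.sum_congr rfl h1, Finset.sum_const, Finset.card_univ, ← Nat.card_eq_fintype_card,
      card_rootedLabelledTree (Finset.card_pos.1 (by omega)), hSa, nsmul_eq_mul]
    field_simp
  rw [Finset.sum_congr rfl hS, Finset.sum_const, Finset.card_powersetCard, Finset.card_univ,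
    Fintype.card_fin, nsmul_eq_mul, mul_one_div]
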